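/- Let $K$ be a field of characteristic zero, let $S=K[x_1,\dots,x_5,y_1,\dots,y_5,z_1,\dots,z_5]$ with the standard grading, and for $1\le a<b<c\le 5$ let $\Delta_{abc}$ be the $3$-minor on the columns $a,b,c$ of the generic matrix $$M=\begin{pmatrix}x_1&x_2&x_3&x_4&x_5\\ y_1&y_2&y_3&y_4&y_5\\ z_1&z_2&z_3&z_4&z_5\end{pmatrix}.$$ Put $f_1=\Delta_{123}$, $f_2=\Delta_{124}$, $f_3=\Delta_{134}$, $f_4=\Delta_{234}$, $f_5=\Delta_{125}$, $f_6=\Delta_{135}$, $f_7=\Delta_{235}$, $f_8=\Delta_{145}$, $f_9=\Delta_{245}$, and $Q_k=f_1f_2f_3f_4f_5f_k$, a form of degree $18$. For a form $F\in S$ let $J_F$ be the ideal generated by the $15$ first partial derivatives of $F$, and let $\operatorname{reg}(S/J_F)$ be the Castelnuovo–Mumford regularity, i.e. the largest $a-i$ such that $S(-a)$ is a direct summand of the $i$-th module of the minimal graded free resolution of $S/J_F$. Then for each $k\in\{6,7,8,9\}$ $$\operatorname{reg}(S/J_{Q_k})=19.$$ Moreover, this is the upper bound on the regularity for free hypersurfaces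 of this degree in $\mathbb P^{14}$. Precisely, call a form $F\in S$ *free and not a cone* if it is squarefree, its first partial derivatives are linearly independent over $K$, and the graded $S$-module $\{(a_s)\in S^{15}:\sum_s a_s\,\partial F/\partial s=0\}$, where $s$ runs over the $15$ variables, has a basis consisting of homogeneous elements. Then each $Q_k$, $k\in\{6,7,8,9\}$, is free and not a cone, and every form $F\in S$ of degree $18$ that is free and not a cone satisfies $\operatorname{reg}(S/J_F)\le 19$. -/

import Mathlib

open MvPolynomial

noncomputable section

/-! ### Minimal graded free resolutions and Castelnuovo-Mumford regularity -/

/-- `p` is homogeneous of the (integer) degree `e`; the zero polynomial is homogeneous of every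
degree, and it is the only one of negative degree. -/
def IsHomogeneousOfDegree {σ K : Type*} [Field K] (p : MvPolynomial σ K) (e : ℤ) : Prop :=
  p = 0 ∨ ∃ n : ℕ, (n : ℤ) = e ∧ p.IsHomogeneous n

/-- A graded free resolution
`⋯ → F₂ → F₁ → F₀ → S ⧸ I → 0` of `S ⧸ I` by finitely generated graded free modules
`F i = ⨁ j, S(-deg i j)`, where `S = K[x_s : s ∈ σ]` has the standard grading.
The `j`-th standard basis vector of `F i` has degree `deg i j`, and all maps have degree zero. -/
structure GradedFreeResolution {σ K : Type*} [Field K] (I : Ideal (MvPolynomial σ K)) where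
  /-- the rank of `F i` -/
  rank : ℕ → ℕ
  /-- the degrees of the standard basis vectors of `F i` -/
  deg : (i : ℕ) → Fin (rank i) → ℤ
  /-- the augmentation `F 0 → S ⧸ I` -/
  aug : (Fin (rank 0) → MvPolynomial σ K) →ₗ[MvPolynomial σ K] (MvPolynomial σ K ⧸ I)
  /-- the differential `F (i + 1) → F i` -/
  d : (i : ℕ) →
    (Fin (rank (i + 1)) → MvPolynomial σ K) →ₗ[MvPolynomial σ K] (Fin (rank i) → MvPolynomial σ K)
  aug_homogeneous : ∀ j, ∃ p : MvPolynomial σ K,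
    IsHomogeneousOfDegree p (deg 0 j) ∧ aug (Pi.single j 1) = Ideal.Quotient.mk I p
  d_homogeneous : ∀ i j k,
    IsHomogeneousOfDegree (d i (Pi.single j 1) k) (deg (i + 1) j - deg i k)
  aug_surjective : Function.Surjective aug
  exact_aug : Function.Exact (d 0) aug
  exact_d : ∀ i, Function.Exact (d (i + 1)) (d i)

/-- The resolution is minimal: `d (F (i + 1)) ⊆ 𝔪 F i` with `𝔪` the ideal of the variables, that is,
no entry of a matrix of a differential has a nonzero constant term. -/
def GradedFreeResolution.IsMinimal {σ K : Type*} [Field K] {I : Ideal (MvPolynomial σ K)}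
    (R : GradedFreeResolution I) : Prop :=
  ∀ i j k, constantCoeff (R.d i (Pi.single j 1) k) = 0

/-- The set of the integers `a - i` such that `S(-a)` is a summand of the `i`-th module of a
minimal graded free resolution of `S ⧸ I` (the rows of the Betti table of `S ⧸ I`). -/
def bettiRows {σ K : Type*} [Field K] (I : Ideal (MvPolynomial σ K)) : Set ℤ :=
  {r | ∃ R : GradedFreeResolution I, R.IsMinimal ∧ ∃ i j, r = R.deg i j - (i : ℤ)}

/-- `reg (S ⧸ I) = r`: the Castelnuovo-Mumford regularity of `S ⧸ I`, the largest `a - i` such that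
`S(-a)` is a summand of the `i`-th module of the minimal graded free resolution. -/
def HasRegularity {σ K : Type*} [Field K] (I : Ideal (MvPolynomial σ K)) (r : ℤ) : Prop :=
  IsGreatest (bettiRows I) r

/-! ### Jacobian ideals and free hypersurfaces -/

/-- The Jacobian ideal `J_F`, generated by the first partial derivatives of `F`. -/
def jacobianIdeal {σ K : Type*} [Field K] (F : MvPolynomial σ K) : Ideal (MvPolynomial σ K) :=
  Ideal.span (Set.range fun s => pderiv s F)

/-- The module `AR(F)` of Jacobian syzygies: all `(a_s)` with `∑ a_s ∂F/∂x_s = 0`. -/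
def jacobianSyzygies {σ K : Type*} [Fintype σ] [Field K] (F : MvPolynomial σ K) :
    Submodule (MvPolynomial σ K) (σ → MvPolynomial σ K) where
  carrier := {a | ∑ s, a s * pderiv s F = 0}
  add_mem' {a b} ha hb := by
    simp only [Set.mem_ofPred_eq] at ha hb
    simp [add_mul, Finset.sum_add_distrib, ha, hb]
  zero_mem' := by simp
  smul_mem' c a ha := by
    simp only [Set.mem_ofPred_eq] at ha
    simp [mul_assoc, ← Finset.mul_sum, ha]

/-- `F` defines a free reduced hypersurface of degree `D` which is not a cone: `F` is homogeneous of
degree `D` and squarefree, its partial derivatives are linearly independent over `K` (no linear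
change of coordinates eliminates a variable), and the graded module of Jacobian syzygies
is free: it has a basis of homogeneous elements. -/
structure IsFreeHypersurface {σ K : Type*} [Fintype σ] [Field K]
    (F : MvPolynomial σ K) (D : ℕ) : Prop where
  homogeneous : F.IsHomogeneous D
  reduced : Squarefree F
  not_cone : LinearIndependent K fun s => pderiv s F
  free : ∃ (m : ℕ) (e : Fin m → ℕ)
    (b : Module.Basis (Fin m) (MvPolynomial σ K) (jacobianSyzygies F)),
    ∀ i s, ((b i : σ → MvPolynomial σ K) s).IsHomogeneous (e i)

/-! ### The determinantal arrangements -/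

/-- The `3`-minor, on the columns `a, b, c`, of the generic `3 × 5` matrix of indeterminates. -/
def genericMinor (K : Type*) [Field K] (a b c : Fin 5) : MvPolynomial (Fin 3 × Fin 5) K :=
  Matrix.det (Matrix.of fun (r t : Fin 3) => X (r, (![a, b, c] : Fin 3 → Fin 5) t))

/-- The ten maximal minors `f₁, …, f₁₀` of the generic `3 × 5` matrix; the columns are numbered
`0, …, 4` here. The value at an index outside `{1, …, 10}` is irrelevant. -/
def detMinor (K : Type*) [Field K] : ℕ → MvPolynomial (Fin 3 × Fin 5) K
  | 1 => genericMinor K 0 1 2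
  | 2 => genericMinor K 0 1 3
  | 3 => genericMinor K 0 2 3
  | 4 => genericMinor K 1 2 3
  | 5 => genericMinor K 0 1 4
  | 6 => genericMinor K 0 2 4
  | 7 => genericMinor K 1 2 4
  | 8 => genericMinor K 0 3 4
  | 9 => genericMinor K 1 3 4
  | 10 => genericMinor K 2 3 4
  | _ => 0

/-- `Q_k = f₁ f₂ f₃ f₄ f₅ f_k`. -/
def midQ (K : Type*) [Field K] (k : ℕ) : MvPolynomial (Fin 3 × Fin 5) K :=
  detMinor K 1 * detMinor K 2 * detMinor K 3 * detMinor K 4 * detMinor K 5 * detMinor K k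

end

/-!
For a form `F` of degree `d + 1` in `n` variables that is free and not a cone, let `e₁, …, e_m` be the
degrees of a homogeneous basis of the Jacobian syzygies. The complex
`0 → ⨁ S(-d - eᵢ) → S(-d)ⁿ → S` is a minimal resolution of `S ⧸ J_F`, because `eᵢ ≥ 1` when `F` is not a
cone. Every other minimal resolution has the same degrees
(`GradedFreeResolution.IsMinimal.deg_sub_eq`): its first module has a basis whose images generate `J_F`
minimally, so it is `S(-d)ⁿ` up to an invertible matrix of constants; its second module then maps
minimally onto the free module of syzygies, and a minimal map onto a free module is injective
(`eq_zero_of_map_eq_zero`). Hence the regularity is `d - 2 + max eᵢ` (`hasRegularity_jacobianIdeal`).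

The bound comes from Saito's theorem `m = n - 1` and `∑ eᵢ = d`
(`sum_degrees_of_basis_jacobianSyzygies`). The matrix with the Euler field and the basis of syzygies as
rows has a determinant divisible by `F`, since a squarefree polynomial in characteristic zero shares no
prime factor with its gradient. The quotient is constant: up to a constant factor, the gradient of `F`
times the quotient is the vector of maximal minors of the basis, and a prime dividing the quotient
would make the basis linearly dependent modulo that prime. As all `eᵢ` are at least `1`, the largest
one is at most `d - n + 2`, which is `4` for `d = 17` and `n = 15`.

For the products `Q_k` the basis is found with Saito's criterion, the converse statement
(`exists_basis_jacobianSyzygies`). Up to sign and a permutation of the columns, each `Q_k` is the product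
of the minors on the columns `abc, abd, acd, bcd, abe, ace`. Its logarithmic vector fields include the
row operations, the scalings of the columns, the field which moves the column `e` along the column `a`,
and `Δ_{ace}` times the field which moves the column `e` along the column `b`. Corrected by multiples
of the Euler field, they give thirteen linear syzygies and one syzygy of degree four, and their
independence is checked at one point. The degrees add up to `17`, so these syzygies form a basis, and
the regularity is `17 - 2 + 4 = 19`.
-/

noncomputable section

/-! ### Squarefree forms and their gradients -/

section Gradient

variable {σ K : Type*} [Field K]

lemma degreeOf_pderiv_lt {p : MvPolynomial σ K} {s : σ} (h : pderiv s p ≠ 0) :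
    degreeOf s (pderiv s p) < degreeOf s p := by
  have key : ∀ m ∈ (pderiv s p).support, m s < degreeOf s p := by
    intro m hm
    have h1 : coeff (m + Finsupp.single s 1) p ≠ 0 := by
      intro h0
      rw [mem_support_iff, coeff_pderiv, h0, zero_mul] at hm
      exact hm rfl
    have := monomial_le_degreeOf s (mem_support_iff.mpr h1)
    simp at this
    omega
  obtain ⟨m, hm⟩ := support_nonempty.mpr h
  rw [degreeOf_lt_iff (by have := key m hm; omega)]
  exact key

/-- In characteristic zero a prime polynomial does not divide all its partial derivatives: they
have smaller degree, and they do not all vanish. -/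
lemma exists_not_dvd_pderiv [CharZero K] {p : MvPolynomial σ K} (hp : Prime p) :
    ∃ s, ¬ p ∣ pderiv s p := by
  classical
  by_contra! h
  have h0 : ∀ s, pderiv s p = 0 := by
    intro s
    by_contra hs
    have h1 := degreeOf_pderiv_lt hs
    obtain ⟨q, hq⟩ := h s
    have hq0 : q ≠ 0 := by rintro rfl; exact hs (by simpa using hq)
    have h2 := degreeOf_mul_eq (n := s) hp.ne_zero hq0
    rw [← hq] at h2
    omega
  have hC : p = C (coeff 0 p) := by
    ext m
    rw [coeff_C]
    split_ifs with hm
    · rw [hm]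
    · obtain ⟨s, hs⟩ : ∃ s, m s ≠ 0 := by
        by_contra! hc
        exact hm (Finsupp.ext fun s => (hc s).symm)
      have h1 := coeff_pderiv (i := s) p (m - Finsupp.single s 1)
      have h2 : m - Finsupp.single s 1 + Finsupp.single s 1 = m :=
        tsub_add_cancel_of_le (by simpa using Nat.one_le_iff_ne_zero.mpr hs)
      rw [h0, coeff_zero, h2] at h1
      have h3 : (((m - Finsupp.single s 1 : σ →₀ ℕ) s : ℕ) : K) + 1 ≠ 0 :=
        Nat.cast_add_one_ne_zero _
      exact (mul_eq_zero.mp h1.symm).resolve_right h3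
  have hc : coeff 0 p ≠ 0 := by
    intro hc
    rw [hc, C_0] at hC
    exact hp.ne_zero hC
  exact hp.not_isUnit (by rw [hC]; exact (isUnit_iff_ne_zero.mpr hc).map C)

lemma Squarefree.dvd_of_forall_prime_dvd {R : Type*} [CommRing R] [IsDomain R]
    [UniqueFactorizationMonoid R] {a b : R} (ha : Squarefree a)
    (h : ∀ p, Prime p → p ∣ a → p ∣ b) : a ∣ b := by
  induction a using UniqueFactorizationMonoid.induction_on_prime with
  | h₁ => exact absurd ha not_squarefree_zero
  | h₂ x hx => exact hx.dvd
  | h₃ a p _ hp ih =>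
    exact (IsRelPrime.of_squarefree_mul ha).mul_dvd (h p hp (dvd_mul_right _ _))
      (ih ha.of_mul_right fun q hq hqa => h q hq (hqa.mul_left _))

/-- A squarefree polynomial shares no prime factor with all its partial derivatives. -/
lemma Squarefree.dvd_of_forall_dvd_mul_pderiv [CharZero K] {F q : MvPolynomial σ K}
    (hF : Squarefree F) (h : ∀ s, F ∣ q * pderiv s F) : F ∣ q := by
  refine hF.dvd_of_forall_prime_dvd fun p hp ⟨g, hg⟩ => ?_
  obtain ⟨s, hs⟩ := exists_not_dvd_pderiv hp
  have h1 : p ∣ q * (p * pderiv s g + pderiv s p * g) := by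
    have := (Dvd.intro g hg.symm).trans (h s)
    rwa [hg, pderiv_mul, add_comm, ] at this
  have h2 : p ∣ q * (pderiv s p * g) := by
    rw [mul_add] at h1
    exact (dvd_add_right ((dvd_mul_right p _).mul_left q)).mp h1
  have hg' : ¬ p ∣ g := by
    rintro ⟨k, rfl⟩
    exact hp.not_isUnit (hF p ⟨k, by rw [hg, mul_assoc]⟩)
  rcases hp.dvd_or_dvd h2 with h3 | h3
  · exact h3
  · exact absurd h3 fun h3 => (hp.dvd_or_dvd h3).elim hs hg'

end Gradient

/-! ### Determinants of logarithmic vector fields -/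

section Saito

variable {σ K : Type*} [Fintype σ] [DecidableEq σ] [Field K]

/-- The determinant of a square matrix whose rows are logarithmic along `F` (they map `F` to a
multiple of `F`) is divisible by `F`: multiply `A ∇F = F u` by the adjugate of `A`. -/
lemma dvd_det_of_forall_dvd [CharZero K] {F : MvPolynomial σ K} (hF : Squarefree F)
    (A : Matrix σ σ (MvPolynomial σ K)) (h : ∀ i, F ∣ ∑ s, A i s * pderiv s F) : F ∣ A.det := by
  refine hF.dvd_of_forall_dvd_mul_pderiv fun s => ?_
  choose u hu using h
  have h1 : A.mulVec (fun s => pderiv s F) = F • u := by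
    ext1 i
    simpa [Matrix.mulVec, dotProduct] using hu i
  have h2 : A.det • (fun s => pderiv s F) = A.adjugate.mulVec (F • u) := by
    rw [← h1, Matrix.mulVec_mulVec, Matrix.adjugate_mul, Matrix.smul_mulVec, Matrix.one_mulVec]
  have h3 := congrFun h2 s
  rw [Matrix.mulVec_smul] at h3
  simp only [Pi.smul_apply, smul_eq_mul] at h3
  rw [h3]
  exact dvd_mul_right _ _

lemma isHomogeneous_det {A : Matrix σ σ (MvPolynomial σ K)} {e : σ → ℕ}
    (h : ∀ i s, (A i s).IsHomogeneous (e i)) : A.det.IsHomogeneous (∑ i, e i) := by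
  rw [Matrix.det_apply]
  refine IsHomogeneous.sum _ _ _ fun τ _ => ?_
  have h1 : (∏ i, A (τ i) i).IsHomogeneous (∑ i, e i) := by
    rw [← Equiv.sum_comp τ e]
    exact IsHomogeneous.prod _ _ _ fun i _ => h _ _
  rcases Int.units_eq_one_or (Equiv.Perm.sign τ) with hs | hs
  · simpa [hs] using h1
  · simpa [hs] using h1.neg

end Saito

section Bordered

variable {σ ι R : Type*} (ε : Option ι ≃ σ) (v w : σ → R) (b : ι → σ → R)

/-- The square matrix with the row `v` at `ε none` and the rows `b i` at `ε (some i)`. -/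
def borderedMatrix {σ ι R : Type*} (ε : Option ι ≃ σ) (v : σ → R) (b : ι → σ → R) :
    Matrix σ σ R :=
  Matrix.of fun i => (ε.symm i).elim v b

@[simp] lemma borderedMatrix_none : borderedMatrix ε v b (ε none) = v := by
  ext1 s; simp [borderedMatrix]

@[simp] lemma borderedMatrix_some (i : ι) : borderedMatrix ε v b (ε (some i)) = b i := by
  ext1 s; simp [borderedMatrix]

lemma borderedMatrix_eq_updateRow [DecidableEq σ] :
    borderedMatrix ε v b = (borderedMatrix ε w b).updateRow (ε none) v := by
  ext i s
  obtain ⟨j, rfl⟩ := ε.surjective i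
  cases j with
  | none => simp
  | some j => rw [Matrix.updateRow_ne (by simp)]; simp

end Bordered

/-! ### Saito's criterion -/

section Saito

variable {σ K : Type*} [Fintype σ] [Field K]

lemma mem_jacobianSyzygies {F : MvPolynomial σ K} {a : σ → MvPolynomial σ K} :
    a ∈ jacobianSyzygies F ↔ ∑ s, a s * pderiv s F = 0 := Iff.rfl

lemma sum_linearCombination_mul_pderiv {F : MvPolynomial σ K} {D : ℕ}
    (hF : F.IsHomogeneous D) (c : MvPolynomial σ K) {a : σ → MvPolynomial σ K}
    (ha : a ∈ jacobianSyzygies F) :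
    ∑ s, (c • (X : σ → MvPolynomial σ K) + a) s * pderiv s F = c * (D * F) := by
  have h1 := hF.sum_X_mul_pderiv
  rw [nsmul_eq_mul] at h1
  rw [mem_jacobianSyzygies] at ha
  simp only [Pi.add_apply, Pi.smul_apply, smul_eq_mul, add_mul, Finset.sum_add_distrib, ha,
    add_zero, mul_assoc, ← Finset.mul_sum, h1]

/-- Every vector field `w`, multiplied by `D F`, is a multiple of the Euler field plus a syzygy. -/
lemma smul_sub_smul_mem_jacobianSyzygies {F : MvPolynomial σ K} {D : ℕ}
    (hF : F.IsHomogeneous D) (w : σ → MvPolynomial σ K) :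
    ((D : MvPolynomial σ K) * F) • w - (∑ s, w s * pderiv s F) • X ∈ jacobianSyzygies F := by
  have h1 := hF.sum_X_mul_pderiv
  rw [nsmul_eq_mul] at h1
  rw [mem_jacobianSyzygies]
  simp only [Pi.sub_apply, Pi.smul_apply, smul_eq_mul, sub_mul, Finset.sum_sub_distrib,
    mul_assoc _ _ (pderiv _ F), ← Finset.mul_sum, h1]
  ring

lemma exists_pderiv_ne_zero [CharZero K] {F : MvPolynomial σ K} {D : ℕ}
    (hF : F.IsHomogeneous D) (hD : D ≠ 0) (hF0 : F ≠ 0) : (fun s => pderiv s F) ≠ 0 := by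
  intro h
  have h1 := hF.sum_X_mul_pderiv
  rw [nsmul_eq_mul] at h1
  refine mul_ne_zero (Nat.cast_ne_zero.mpr hD) hF0 (h1.symm.trans ?_)
  exact Finset.sum_eq_zero fun s _ => by rw [show pderiv s F = 0 from congrFun h s, mul_zero]

/-- The Euler field is independent of the syzygies, and together they span a submodule of full rank:
it contains `D F w` for each vector field `w`. -/
lemma card_add_one_of_basis_jacobianSyzygies [CharZero K] {F : MvPolynomial σ K} {D : ℕ}
    (hF : F.IsHomogeneous D) (hD : D ≠ 0) (hF0 : F ≠ 0) {ι : Type*} [Fintype ι]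
    (B : Module.Basis ι (MvPolynomial σ K) (jacobianSyzygies F)) :
    Fintype.card ι + 1 = Fintype.card σ := by
  have hDF : (D : MvPolynomial σ K) * F ≠ 0 := mul_ne_zero (Nat.cast_ne_zero.mpr hD) hF0
  have : Module.Free (MvPolynomial σ K) (jacobianSyzygies F) := Module.Free.of_basis B
  have : Module.Finite (MvPolynomial σ K) (jacobianSyzygies F) := Module.Finite.of_basis B
  have hr : Module.finrank (MvPolynomial σ K) (MvPolynomial σ K × jacobianSyzygies F)
      = 1 + Fintype.card ι := by
    rw [Module.finrank_prod, Module.finrank_self, Module.finrank_eq_card_basis B]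
  have hs : Module.finrank (MvPolynomial σ K) (σ → MvPolynomial σ K) = Fintype.card σ :=
    Module.finrank_fintype_fun_eq_card _
  apply le_antisymm
  · let f : (MvPolynomial σ K × jacobianSyzygies F) →ₗ[MvPolynomial σ K] (σ → MvPolynomial σ K) :=
      (LinearMap.toSpanSingleton _ _ X).coprod (jacobianSyzygies F).subtype
    have hf : Function.Injective ⇑f := by
      rw [injective_iff_map_eq_zero]
      rintro ⟨c, a⟩ h
      have h0 : c • X + (a : σ → MvPolynomial σ K) = 0 := by simpa [f] using h
      have h1 := sum_linearCombination_mul_pderiv hF c a.2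
      simp only [h0, Pi.zero_apply, zero_mul, Finset.sum_const_zero] at h1
      have hc : c = 0 := (mul_eq_zero.mp h1.symm).resolve_right hDF
      subst hc
      simpa using h0
    have := LinearMap.finrank_le_finrank_of_injective hf
    omega
  · let g : (σ → MvPolynomial σ K) →ₗ[MvPolynomial σ K] (MvPolynomial σ K × jacobianSyzygies F) :=
      { toFun := fun w => (∑ s, w s * pderiv s F, ⟨_, smul_sub_smul_mem_jacobianSyzygies hF w⟩)
        map_add' := fun w w' => by
          ext1
          · simp [add_mul, Finset.sum_add_distrib]
          · ext1
            simp only [Pi.add_apply, add_mul, Finset.sum_add_distrib, Prod.snd_add,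
              Submodule.coe_add]
            module
        map_smul' := fun c w => by
          ext1
          · simp [mul_assoc, Finset.mul_sum]
          · ext1
            simp only [Pi.smul_apply, smul_eq_mul, mul_assoc c, ← Finset.mul_sum, Prod.smul_snd,
              Submodule.coe_smul, RingHom.id_apply]
            module }
    have hg : Function.Injective g := by
      rw [injective_iff_map_eq_zero]
      intro w hw
      have h1 : ∑ s, w s * pderiv s F = 0 := congrArg Prod.fst hw
      have h2 : ((D : MvPolynomial σ K) * F) • w - (∑ s, w s * pderiv s F) • X = 0 :=
        congrArg (fun x => (x.2 : σ → MvPolynomial σ K)) hw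
      rw [h1, zero_smul, sub_zero] at h2
      exact (smul_eq_zero.mp h2).resolve_left hDF
    have := LinearMap.finrank_le_finrank_of_injective hg
    omega

/-- Expressing `D F w` through the Euler field and a syzygy compares the determinants bordered by
`w` and by the Euler field. -/
lemma det_borderedMatrix_eq [DecidableEq σ] [CharZero K] {F : MvPolynomial σ K} {D : ℕ}
    (hF : F.IsHomogeneous D) (hD : D ≠ 0) (hF0 : F ≠ 0) {ι : Type*} (ε : Option ι ≃ σ)
    {b : ι → σ → MvPolynomial σ K} (hb : ∀ i, b i ∈ jacobianSyzygies F)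
    (w : σ → MvPolynomial σ K) :
    D * F * (borderedMatrix ε w b).det
      = (∑ s, w s * pderiv s F) * (borderedMatrix ε X b).det := by
  have h0 : (borderedMatrix ε (((D : MvPolynomial σ K) * F) • w
      - (∑ s, w s * pderiv s F) • X) b).det = 0 := by
    rw [← Matrix.exists_mulVec_eq_zero_iff]
    refine ⟨_, exists_pderiv_ne_zero hF hD hF0, ?_⟩
    ext1 i
    obtain ⟨j, rfl⟩ := ε.surjective i
    cases j with
    | none =>
      rw [Matrix.mulVec, borderedMatrix_none]
      exact smul_sub_smul_mem_jacobianSyzygies hF w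
    | some j =>
      rw [Matrix.mulVec, borderedMatrix_some]
      exact hb j
  rw [borderedMatrix_eq_updateRow ε _ X, sub_eq_add_neg, ← neg_smul, Matrix.det_updateRow_add,
    Matrix.det_updateRow_smul, Matrix.det_updateRow_smul, ← borderedMatrix_eq_updateRow,
    ← borderedMatrix_eq_updateRow] at h0
  linear_combination h0

lemma isHomogeneous_det_borderedMatrix [DecidableEq σ] {ι : Type*} [Fintype ι] (ε : Option ι ≃ σ)
    {b : ι → σ → MvPolynomial σ K} {e : ι → ℕ} (he : ∀ i s, (b i s).IsHomogeneous (e i)) :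
    (borderedMatrix ε X b).det.IsHomogeneous (∑ i, e i + 1) := by
  have h1 : ∑ i, (ε.symm i).elim 1 e = ∑ i, e i + 1 := by
    rw [← Equiv.sum_comp ε, Fintype.sum_option]
    simp [add_comm]
  rw [← h1]
  refine isHomogeneous_det fun i s => ?_
  obtain ⟨j, rfl⟩ := ε.surjective i
  cases j with
  | none => simpa using isHomogeneous_X K s
  | some j => simpa using he j s

lemma dvd_det_borderedMatrix [DecidableEq σ] [CharZero K] {F : MvPolynomial σ K} {D : ℕ}
    (hF : F.IsHomogeneous D) (hsq : Squarefree F) {ι : Type*} (ε : Option ι ≃ σ)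
    {b : ι → σ → MvPolynomial σ K} (hb : ∀ i, b i ∈ jacobianSyzygies F) :
    F ∣ (borderedMatrix ε X b).det := by
  refine dvd_det_of_forall_dvd hsq _ fun i => ?_
  obtain ⟨j, rfl⟩ := ε.surjective i
  cases j with
  | none =>
    rw [borderedMatrix_none, hF.sum_X_mul_pderiv, nsmul_eq_mul]
    exact dvd_mul_left _ _
  | some j =>
    rw [borderedMatrix_some, mem_jacobianSyzygies.mp (hb j)]
    exact dvd_zero _

lemma linearIndependent_borderedMatrix_iff {R ι : Type*} [CommRing R] [IsDomain R] [DecidableEq σ]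
    (ε : Option ι ≃ σ) (v : σ → R) (b : ι → σ → R) :
    (borderedMatrix ε v b).det ≠ 0 ↔
      LinearIndependent R (fun i : Option ι => i.elim v b) := by
  rw [← linearIndependent_equiv ε.symm]
  constructor
  · intro h
    exact Matrix.linearIndependent_rows_of_det_ne_zero h
  · intro h h0
    obtain ⟨c, hc, hc0⟩ := Matrix.exists_vecMul_eq_zero_iff.mpr h0
    refine hc (funext fun i => Fintype.linearIndependent_iff.mp h c ?_ i)
    rw [← hc0]
    ext1 s
    simp [Matrix.vecMul, dotProduct, borderedMatrix]

/-- **Saito's criterion.** Homogeneous syzygies of `F` which are independent of the Euler field and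
whose degrees add up to `deg F - 1` form a basis of the module of syzygies. -/
theorem exists_basis_jacobianSyzygies [DecidableEq σ] [CharZero K] {F : MvPolynomial σ K} {D : ℕ}
    (hF : F.IsHomogeneous D) (hD : D ≠ 0) (hsq : Squarefree F) {ι : Type*} [Fintype ι]
    (ε : Option ι ≃ σ) {b : ι → σ → MvPolynomial σ K} (hb : ∀ i, b i ∈ jacobianSyzygies F)
    {e : ι → ℕ} (he : ∀ i s, (b i s).IsHomogeneous (e i)) (hsum : ∑ i, e i + 1 = D)
    (hdet : (borderedMatrix ε X b).det ≠ 0) :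
    ∃ B : Module.Basis ι (MvPolynomial σ K) (jacobianSyzygies F),
      ∀ i, (B i : σ → MvPolynomial σ K) = b i := by
  have hF0 := hsq.ne_zero
  set A := borderedMatrix ε X b with hA
  -- by degree, the quotient of the determinant by `F` is a constant
  have hdvd : A.det ∣ F := by
    obtain ⟨q, hq⟩ := dvd_det_borderedMatrix hF hsq ε hb
    have hq0 : q ≠ 0 := by
      rintro rfl
      exact hdet (by rw [hq, mul_zero])
    have h1 := (isHomogeneous_det_borderedMatrix ε he).totalDegree hdet
    rw [hq, totalDegree_mul_of_isDomain hF0 hq0, hF.totalDegree hF0] at h1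
    have h2 : q = C (q.coeff 0) := totalDegree_eq_zero_iff_eq_C.mp (by omega)
    have h3 : q.coeff 0 ≠ 0 := by
      intro h3
      rw [h3, C_0] at h2
      exact hq0 h2
    refine ⟨C (q.coeff 0)⁻¹, ?_⟩
    rw [hA, hq, h2, mul_assoc, ← C_mul, coeff_C, if_pos rfl, mul_inv_cancel₀ h3, C_1, mul_one]
  have hli := (linearIndependent_borderedMatrix_iff ε X b).mp hdet
  have hlib : LinearIndependent (MvPolynomial σ K) b :=
    hli.comp some (Option.some_injective _)
  have hspan : jacobianSyzygies F ≤ Submodule.span (MvPolynomial σ K) (Set.range b) := by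
    intro v hv
    have h1 : ∀ i, A.det ∣ Matrix.cramer A.transpose v i := by
      intro i
      rw [Matrix.cramer_transpose_apply]
      refine hdvd.trans (dvd_det_of_forall_dvd hsq _ fun j => ?_)
      by_cases hj : j = i
      · subst hj
        rw [Matrix.updateRow_self, mem_jacobianSyzygies.mp hv]
        exact dvd_zero _
      · rw [Matrix.updateRow_ne hj]
        obtain ⟨k, rfl⟩ := ε.surjective j
        cases k with
        | none =>
          rw [hA, borderedMatrix_none, hF.sum_X_mul_pderiv, nsmul_eq_mul]
          exact dvd_mul_left _ _
        | some k =>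
          rw [hA, borderedMatrix_some, mem_jacobianSyzygies.mp (hb k)]
          exact dvd_zero _
    choose c hc using h1
    have h2 := Matrix.mulVec_cramer A.transpose v
    rw [show Matrix.cramer A.transpose v = A.det • c from funext hc, Matrix.mulVec_smul,
      Matrix.det_transpose] at h2
    have h3 : A.transpose.mulVec c = v := smul_right_injective _ hdet h2
    have h4 : v = c (ε none) • X + ∑ i, c (ε (some i)) • b i := by
      rw [← h3, Matrix.mulVec_transpose, Matrix.vecMul_eq_sum, ← Equiv.sum_comp ε,
        Fintype.sum_option, hA]
      simp only [borderedMatrix_none, borderedMatrix_some]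
    have h5 : ∑ i, c (ε (some i)) • b i ∈ jacobianSyzygies F :=
      Submodule.sum_mem _ fun i _ => Submodule.smul_mem _ _ (hb i)
    have h6 := sum_linearCombination_mul_pderiv hF (c (ε none)) h5
    rw [← h4, mem_jacobianSyzygies.mp hv] at h6
    have h7 : c (ε none) = 0 := (mul_eq_zero.mp h6.symm).resolve_right
      (mul_ne_zero (Nat.cast_ne_zero.mpr hD) hF0)
    rw [h4, h7, zero_smul, zero_add]
    exact Submodule.sum_mem _ fun i _ =>
      Submodule.smul_mem _ _ (Submodule.subset_span ⟨i, rfl⟩)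
  let b' : ι → jacobianSyzygies F := fun i => ⟨b i, hb i⟩
  have hb' : LinearIndependent (MvPolynomial σ K) b' :=
    LinearIndependent.of_comp (jacobianSyzygies F).subtype hlib
  have hspan' : ⊤ ≤ Submodule.span (MvPolynomial σ K) (Set.range b') := by
    rintro ⟨v, hv⟩ -
    obtain ⟨c, hc⟩ := (Submodule.mem_span_range_iff_exists_fun _).mp (hspan hv)
    refine (Submodule.mem_span_range_iff_exists_fun _).mpr ⟨c, Subtype.ext ?_⟩
    simpa [b'] using hc
  exact ⟨Module.Basis.mk hb' hspan', fun i => by simp [b']⟩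

/-- Syzygies that are linearly dependent modulo a prime `π` are not a basis: a relation
`∑ cᵢ bᵢ = π v` forces `v` to be a syzygy, hence `π ∣ cᵢ`. -/
lemma linearIndependent_mk_of_basis {F : MvPolynomial σ K} {ι : Type*} [Fintype ι]
    (B : Module.Basis ι (MvPolynomial σ K) (jacobianSyzygies F)) {π : MvPolynomial σ K}
    (hπ : Prime π) :
    LinearIndependent (MvPolynomial σ K ⧸ Ideal.span {π})
      (fun i s => Ideal.Quotient.mk (Ideal.span {π}) ((B i : σ → MvPolynomial σ K) s)) := by
  rw [Fintype.linearIndependent_iff]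
  intro g hg i
  choose c hc using fun i => Ideal.Quotient.mk_surjective (I := Ideal.span {π}) (g i)
  have h1 : ∀ s, π ∣ ∑ i, c i * (B i : σ → MvPolynomial σ K) s := by
    intro s
    rw [← Ideal.mem_span_singleton, ← Ideal.Quotient.eq_zero_iff_mem, map_sum]
    simpa [hc] using congrFun hg s
  choose v hv using h1
  have h2 : ∑ i, c i • (B i : σ → MvPolynomial σ K) = π • v := by
    ext1 s
    simpa using hv s
  have h3 : v ∈ jacobianSyzygies F := by
    have h4 : π • v ∈ jacobianSyzygies F := by
      rw [← h2]
      exact Submodule.sum_mem _ fun i _ => Submodule.smul_mem _ _ (B i).2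
    rw [mem_jacobianSyzygies] at h4 ⊢
    simp only [Pi.smul_apply, smul_eq_mul, mul_assoc, ← Finset.mul_sum] at h4
    exact (mul_eq_zero.mp h4).resolve_left hπ.ne_zero
  have h5 : ∑ i, c i • B i = π • (⟨v, h3⟩ : jacobianSyzygies F) := by
    ext1
    simpa using h2
  have h6 : c i = π * B.repr ⟨v, h3⟩ i := by
    have := congrArg (fun x => B.repr x i) h5
    simp only [map_smul, Finsupp.smul_apply, smul_eq_mul] at this
    rw [← this, ← B.equivFun_apply, ← B.equivFun_symm_apply, LinearEquiv.apply_symm_apply]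
  rw [← hc i, h6, Ideal.Quotient.eq_zero_iff_mem]
  exact Ideal.mul_mem_right _ _ (Ideal.mem_span_singleton_self π)

/-- If the rows `b` stay independent in a field `L`, then bordering them by some standard basis
vector gives a determinant which does not vanish in `L`. -/
lemma exists_map_det_borderedMatrix_ne_zero [DecidableEq σ] {R L ι : Type*} [CommRing R] [Field L]
    [Fintype ι] (ε : Option ι ≃ σ) (φ : R →+* L) (b : ι → σ → R)
    (hli : LinearIndependent L (fun i s => φ (b i s))) :
    ∃ s, φ (borderedMatrix ε (Pi.single s 1) b).det ≠ 0 := by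
  obtain ⟨s, hs⟩ : ∃ s, (Pi.single s 1 : σ → L) ∉
      Submodule.span L (Set.range fun i s => φ (b i s)) := by
    by_contra! hc
    have h1 : Submodule.span L (Set.range fun i s => φ (b i s)) = ⊤ := by
      rw [eq_top_iff, ← (Pi.basisFun L σ).span_eq, Submodule.span_le]
      rintro _ ⟨s, rfl⟩
      rw [Pi.basisFun_apply]
      exact hc s
    have h2 := finrank_span_eq_card hli
    rw [h1, finrank_top, Module.finrank_fintype_fun_eq_card, ← Fintype.card_congr ε,
      Fintype.card_option] at h2
    omega
  have h1 : LinearIndependent L (fun i : Option ι =>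
      i.elim (Pi.single s 1 : σ → L) fun i s => φ (b i s)) := by
    rw [linearIndependent_option]
    exact ⟨hli, hs⟩
  rw [← linearIndependent_borderedMatrix_iff ε] at h1
  have h2 : φ.mapMatrix (borderedMatrix ε (Pi.single s 1) b)
      = borderedMatrix ε (Pi.single s 1 : σ → L) fun i s => φ (b i s) := by
    ext i t
    obtain ⟨j, rfl⟩ := ε.surjective i
    cases j with
    | none =>
      rw [RingHom.mapMatrix_apply, Matrix.map_apply, borderedMatrix_none, borderedMatrix_none]
      simp [Pi.single_apply, apply_ite φ]
    | some j => rw [RingHom.mapMatrix_apply, Matrix.map_apply, borderedMatrix_some,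
        borderedMatrix_some]
  refine ⟨s, ?_⟩
  rwa [RingHom.map_det, h2]

/-- **Saito's theorem.** A homogeneous basis of the syzygies of a squarefree form of degree `D` in
`n` variables has `n - 1` elements, and their degrees add up to `D - 1`. -/
theorem sum_degrees_of_basis_jacobianSyzygies [DecidableEq σ] [CharZero K] {F : MvPolynomial σ K}
    {D : ℕ} (hF : F.IsHomogeneous D) (hD : D ≠ 0) (hsq : Squarefree F) {ι : Type*} [Fintype ι]
    (B : Module.Basis ι (MvPolynomial σ K) (jacobianSyzygies F)) {e : ι → ℕ}
    (he : ∀ i s, ((B i : σ → MvPolynomial σ K) s).IsHomogeneous (e i)) :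
    ∑ i, e i + 1 = D := by
  have hF0 := hsq.ne_zero
  have hcard := card_add_one_of_basis_jacobianSyzygies hF hD hF0 B
  obtain ⟨ε⟩ : Nonempty (Option ι ≃ σ) := by
    rw [← Fintype.card_eq, Fintype.card_option, hcard]
  set b : ι → σ → MvPolynomial σ K := fun i => B i with hb
  have hbF : ∀ i, b i ∈ jacobianSyzygies F := fun i => (B i).2
  obtain ⟨p, hp⟩ := dvd_det_borderedMatrix hF hsq ε hbF
  -- the maximal minors of the basis are, up to `p`, the partial derivatives
  have hminor : ∀ w, (D : MvPolynomial σ K) * (borderedMatrix ε w b).det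
      = p * ∑ s, w s * pderiv s F := by
    intro w
    have h1 := det_borderedMatrix_eq hF hD hF0 ε hbF w
    rw [hp] at h1
    apply mul_left_cancel₀ hF0
    linear_combination h1
  have hbli : LinearIndependent (MvPolynomial σ K) b :=
    B.linearIndependent.map' (jacobianSyzygies F).subtype (Submodule.ker_subtype _)
  have hdet : (borderedMatrix ε X b).det ≠ 0 := by
    rw [linearIndependent_borderedMatrix_iff, Fintype.linearIndependent_iff]
    intro c hc
    have h1 : c none • X + ∑ i, c (some i) • b i = 0 := by
      simpa [Fintype.sum_option] using hc
    have h2 := sum_linearCombination_mul_pderiv hF (c none)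
      (a := ∑ i, c (some i) • b i) (Submodule.sum_mem _ fun i _ => Submodule.smul_mem _ _ (hbF i))
    simp only [h1, Pi.zero_apply, zero_mul, Finset.sum_const_zero] at h2
    have h3 : c none = 0 := (mul_eq_zero.mp h2.symm).resolve_right
      (mul_ne_zero (Nat.cast_ne_zero.mpr hD) hF0)
    rw [h3, zero_smul, zero_add] at h1
    rintro (_ | i)
    · exact h3
    · exact Fintype.linearIndependent_iff.mp hbli _ h1 i
  have hp0 : p ≠ 0 := by
    rintro rfl
    exact hdet (by rw [hp, mul_zero])
  -- modulo a prime factor of `p` the maximal minors vanish, but the basis stays independent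
  have hunit : IsUnit p := by
    by_contra hpu
    obtain ⟨π, hπ, hπp⟩ := WfDvdMonoid.exists_irreducible_factor hpu hp0
    rw [UniqueFactorizationMonoid.irreducible_iff_prime] at hπ
    have : (Ideal.span {π}).IsPrime := (Ideal.span_singleton_prime hπ.ne_zero).mpr hπ
    let Q := MvPolynomial σ K ⧸ Ideal.span {π}
    let L := FractionRing Q
    let φ : MvPolynomial σ K →+* L :=
      (algebraMap Q L).comp (Ideal.Quotient.mk (Ideal.span {π}))
    have hφ : ∀ q, φ q = 0 ↔ π ∣ q := by
      intro q
      rw [← Ideal.mem_span_singleton, ← Ideal.Quotient.eq_zero_iff_mem, RingHom.comp_apply]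
      exact (IsFractionRing.injective Q L).eq_iff' (map_zero _)
    have hli : LinearIndependent L (fun i s => φ (b i s)) := by
      have h1 := linearIndependent_mk_of_basis B hπ
      rw [← LinearIndependent.iff_fractionRing Q L]
      exact h1.map' ((Algebra.linearMap Q L).compLeft σ) (LinearMap.ker_eq_bot.mpr
        fun x y h => funext fun s => IsFractionRing.injective Q L (congrFun h s))
    obtain ⟨s, h1⟩ := exists_map_det_borderedMatrix_ne_zero ε φ b hli
    rw [Ne, hφ] at h1
    have h3 : π ∣ (D : MvPolynomial σ K) * (borderedMatrix ε (Pi.single s 1) b).det := by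
      rw [hminor]
      exact hπp.mul_right _
    refine h1 ((hπ.dvd_or_dvd h3).resolve_left fun h4 => ?_)
    have h5 : IsUnit (D : MvPolynomial σ K) := by
      rw [← map_natCast (C (σ := σ) (R := K))]
      exact (isUnit_iff_ne_zero.mpr (Nat.cast_ne_zero.mpr hD)).map C
    exact hπ.not_isUnit (isUnit_of_dvd_unit h4 h5)
  obtain ⟨-, hdeg⟩ := isUnit_iff_totalDegree_of_isReduced.mp hunit
  have h1 := (isHomogeneous_det_borderedMatrix ε he).totalDegree hdet
  rw [show (borderedMatrix ε X fun i => (B i : σ → MvPolynomial σ K)).det = F * p from hp,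
    totalDegree_mul_of_isDomain hF0 hp0, hF.totalDegree hF0, hdeg] at h1
  omega

/-- A syzygy of degree zero is a linear relation between the partial derivatives. -/
lemma one_le_degree_of_basis_jacobianSyzygies {F : MvPolynomial σ K}
    (hc : LinearIndependent K fun s => pderiv s F) {ι : Type*}
    (B : Module.Basis ι (MvPolynomial σ K) (jacobianSyzygies F)) {e : ι → ℕ}
    (he : ∀ i s, ((B i : σ → MvPolynomial σ K) s).IsHomogeneous (e i)) (i : ι) : 1 ≤ e i := by
  by_contra! h0
  have h1 : ∀ s, (B i : σ → MvPolynomial σ K) s = C (coeff 0 ((B i : σ → MvPolynomial σ K) s)) := by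
    intro s
    have := he i s
    rw [Nat.lt_one_iff.mp h0, ← totalDegree_zero_iff_isHomogeneous] at this
    exact totalDegree_eq_zero_iff_eq_C.mp this
  have h2 := mem_jacobianSyzygies.mp (B i).2
  have h3 := Fintype.linearIndependent_iff.mp hc
    (fun s => coeff 0 ((B i : σ → MvPolynomial σ K) s)) (by
      rw [← h2]
      refine Finset.sum_congr rfl fun s _ => ?_
      rw [smul_eq_C_mul, ← h1])
  refine B.ne_zero i (Subtype.ext (funext fun s => ?_))
  rw [h1, h3, C_0]
  rfl

lemma linearIndependent_pderiv_of_basis {F : MvPolynomial σ K} {ι : Type*} [Fintype ι]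
    (B : Module.Basis ι (MvPolynomial σ K) (jacobianSyzygies F)) {e : ι → ℕ}
    (he : ∀ i s, ((B i : σ → MvPolynomial σ K) s).IsHomogeneous (e i)) (he1 : ∀ i, 1 ≤ e i) :
    LinearIndependent K fun s => pderiv s F := by
  rw [Fintype.linearIndependent_iff]
  intro c hc s
  have h1 : (fun s => C (c s)) ∈ jacobianSyzygies F := by
    rw [mem_jacobianSyzygies, ← hc]
    exact Finset.sum_congr rfl fun s _ => (smul_eq_C_mul _ _).symm
  have h2 := congrArg (fun x : jacobianSyzygies F => constantCoeff ((x : σ → MvPolynomial σ K) s))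
    (B.sum_repr ⟨_, h1⟩)
  have h3 : ∀ i, constantCoeff ((B i : σ → MvPolynomial σ K) s) = 0 := fun i =>
    (he i s).coeff_eq_zero (by have := he1 i; simp; omega)
  simp only [Submodule.coe_sum, Submodule.coe_smul, Finset.sum_apply, Pi.smul_apply, smul_eq_mul,
    map_sum, map_mul, h3, mul_zero, Finset.sum_const_zero, constantCoeff_C] at h2
  exact h2.symm

end Saito

/-! ### Minimal maps of graded free modules -/

section GradedCoefficients

variable {σ K : Type*} [Field K]

/-- The part of `a` which contributes to degree `n` in a product of `a` with a form of degree `e`: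
its homogeneous component of degree `n - e`. -/
def shiftedComponent (n e : ℕ) (a : MvPolynomial σ K) : MvPolynomial σ K :=
  if e ≤ n then homogeneousComponent (n - e) a else 0

lemma homogeneousComponent_mul_right {g : MvPolynomial σ K} {e : ℕ} (hg : g.IsHomogeneous e)
    (n : ℕ) (a : MvPolynomial σ K) :
    homogeneousComponent n (a * g) = shiftedComponent n e a * g := by
  conv_lhs => rw [← sum_homogeneousComponent a, Finset.sum_mul, map_sum]
  have h1 : ∀ i, homogeneousComponent n (homogeneousComponent i a * g)
      = if i + e = n then homogeneousComponent i a * g else 0 := fun i => by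
    rw [homogeneousComponent_of_mem ((homogeneousComponent_isHomogeneous i a).mul hg)]
    simp only [eq_comm]
  rw [Finset.sum_congr rfl fun i _ => h1 i, shiftedComponent]
  split_ifs with h
  · rw [Finset.sum_eq_single (n - e)]
    · rw [if_pos (by omega)]
    · intro i _ hi
      rw [if_neg (by omega)]
    · intro hi
      rw [if_pos (by omega), homogeneousComponent_eq_zero _ _ (by simp at hi; omega), zero_mul]
  · rw [zero_mul]
    exact Finset.sum_eq_zero fun i _ => if_neg (by omega)

lemma constantCoeff_shiftedComponent_of_ne {n e : ℕ} (h : e ≠ n) (a : MvPolynomial σ K) :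
    constantCoeff (shiftedComponent n e a) = 0 := by
  rw [shiftedComponent]
  split_ifs with h1
  · rw [constantCoeff_eq, coeff_homogeneousComponent, if_neg]
    simp only [map_zero]
    omega
  · exact map_zero _

lemma shiftedComponent_self (n : ℕ) (a : MvPolynomial σ K) :
    shiftedComponent n n a = C (constantCoeff a) := by
  rw [shiftedComponent, if_pos le_rfl, Nat.sub_self, homogeneousComponent_zero, constantCoeff_eq]

/-- A homogeneous combination of forms is a combination with homogeneous coefficients. -/
lemma eq_sum_shiftedComponent_mul {ι : Type*} [Fintype ι] {p : MvPolynomial σ K} {n : ℕ}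
    (hp : p.IsHomogeneous n) {g : ι → MvPolynomial σ K} {e : ι → ℕ}
    (hg : ∀ i, (g i).IsHomogeneous (e i)) {a : ι → MvPolynomial σ K} (h : p = ∑ i, a i * g i) :
    p = ∑ i, shiftedComponent n (e i) (a i) * g i := by
  conv_lhs => rw [← homogeneousComponent_eq_self hp, h, map_sum]
  exact Finset.sum_congr rfl fun i _ => homogeneousComponent_mul_right (hg i) n _

lemma IsHomogeneousOfDegree.toNat {p : MvPolynomial σ K} {δ : ℤ}
    (h : IsHomogeneousOfDegree p δ) : p.IsHomogeneous δ.toNat := by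
  rcases h with rfl | ⟨n, rfl, h⟩
  · exact isHomogeneous_zero _ _ _
  · exact h

lemma IsHomogeneousOfDegree.nonneg {p : MvPolynomial σ K} {δ : ℤ}
    (h : IsHomogeneousOfDegree p δ) (hp : p ≠ 0) : 0 ≤ δ := by
  rcases h with h | ⟨n, rfl, -⟩
  · exact absurd h hp
  · exact Int.natCast_nonneg n

end GradedCoefficients

/-! A map `φ` of a free module is called minimal here if its kernel lies in `𝔪` times the module, that
is, if no vector in the kernel has an entry with a nonzero constant term. -/

section MinimalCovers

variable {σ K N ι : Type*} [Field K] [AddCommGroup N] [Module (MvPolynomial σ K) N] {r : ℕ}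
  {φ : (Fin r → MvPolynomial σ K) →ₗ[MvPolynomial σ K] N}

/-- A basis vector cannot be changed modulo `𝔪` without changing its image under a minimal map. -/
lemma constantCoeff_eq_of_map_eq (hφ : ∀ w, φ w = 0 → ∀ k, constantCoeff (w k) = 0)
    {j : Fin r} {w : Fin r → MvPolynomial σ K} (h : φ w = φ (Pi.single j 1)) (k : Fin r) :
    constantCoeff (w k) = if k = j then 1 else 0 := by
  have h1 := hφ (w - Pi.single j 1) (by rw [map_sub, h, sub_self]) k
  rw [Pi.sub_apply, map_sub, sub_eq_zero] at h1
  rw [h1, Pi.single_apply]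
  split_ifs <;> simp

/-- A minimal map sends no basis vector into `𝔪` times its image. -/
lemma map_single_ne_sum [Fintype ι] (hφ : ∀ w, φ w = 0 → ∀ k, constantCoeff (w k) = 0)
    {g : ι → N} (hg : ∀ i, ∃ w, φ w = g i) {a : ι → MvPolynomial σ K}
    (ha : ∀ i, constantCoeff (a i) = 0) (j : Fin r) : φ (Pi.single j 1) ≠ ∑ i, a i • g i := by
  intro h
  choose w hw using hg
  have h1 : φ (∑ i, a i • w i) = φ (Pi.single j 1) := by simp [h, hw]
  have h2 := constantCoeff_eq_of_map_eq hφ h1 j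
  simp [ha] at h2

lemma map_single_ne_zero (hφ : ∀ w, φ w = 0 → ∀ k, constantCoeff (w k) = 0) (j : Fin r) :
    φ (Pi.single j 1) ≠ 0 := by
  have := map_single_ne_sum (ι := Empty) hφ (g := Empty.elim) (fun i => i.elim)
    (a := Empty.elim) (fun i => i.elim) j
  simpa using this

lemma map_eq_sum_smul (u : Fin r → MvPolynomial σ K) :
    φ u = ∑ j, u j • φ (Pi.single j 1) := by
  rw [LinearMap.pi_apply_eq_sum_univ φ u]
  refine Finset.sum_congr rfl fun j _ => ?_
  congr 2
  ext1 k
  simp only [Pi.single_apply, eq_comm]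

/-- A minimal map onto a free module is injective: up to a matrix which is the identity modulo `𝔪`,
every vector is determined by its image. -/
lemma eq_zero_of_map_eq_zero [Fintype ι] (hφ : ∀ w, φ w = 0 → ∀ k, constantCoeff (w k) = 0)
    {g : ι → N} (hg : ∀ i, ∃ w, φ w = g i) (hli : LinearIndependent (MvPolynomial σ K) g)
    (hspan : ∀ j, ∃ a : ι → MvPolynomial σ K, φ (Pi.single j 1) = ∑ i, a i • g i)
    {u : Fin r → MvPolynomial σ K} (hu : φ u = 0) : u = 0 := by
  choose w hw using hg
  choose a ha using hspan
  -- lifts of the basis vectors through the combinations of the `g i` to which they map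
  let T : Matrix (Fin r) (Fin r) (MvPolynomial σ K) := Matrix.of fun j k => ∑ i, a j i * w i k
  have hT : constantCoeff.mapMatrix T = 1 := by
    ext j k
    have h1 : φ (T j) = φ (Pi.single j 1) := by
      have : T j = ∑ i, a j i • w i := by
        ext1 k
        simp [T]
      rw [this, ha, map_sum]
      simp [hw]
    have h2 := constantCoeff_eq_of_map_eq hφ h1 k
    rw [RingHom.mapMatrix_apply, Matrix.map_apply, h2, Matrix.one_apply]
    simp only [eq_comm]
  have hdet : T.det ≠ 0 := by
    intro h
    have h1 := congrArg constantCoeff h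
    rw [RingHom.map_det, hT, Matrix.det_one, map_zero] at h1
    exact one_ne_zero h1
  refine Matrix.eq_zero_of_vecMul_eq_zero hdet ?_
  have h1 : ∑ i, (∑ j, u j * a j i) • g i = 0 := by
    rw [← hu, map_eq_sum_smul u]
    simp only [ha, Finset.smul_sum, Finset.sum_smul, smul_smul]
    exact Finset.sum_comm
  have h2 := Fintype.linearIndependent_iff.mp hli _ h1
  ext1 k
  simp only [Matrix.vecMul, dotProduct, T, Matrix.of_apply, Finset.mul_sum, Pi.zero_apply]
  rw [Finset.sum_comm]
  refine Finset.sum_eq_zero fun i _ => ?_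
  simp only [← mul_assoc, ← Finset.sum_mul, h2, zero_mul]

end MinimalCovers

section EqualDegrees

variable {σ K ι : Type*} [Field K] [Fintype ι] {r : ℕ}
  {φ : (Fin r → MvPolynomial σ K) →ₗ[MvPolynomial σ K] MvPolynomial σ K}
  {g : ι → MvPolynomial σ K} {d : ℕ} {δ : Fin r → ℤ}

/-- Minimal generators of an ideal generated by forms of degree `d` have degree `d`. -/
lemma degree_eq_of_minimal (hφ : ∀ w, φ w = 0 → ∀ k, constantCoeff (w k) = 0)
    (hrange : ∀ q, (∃ w, φ w = q) ↔ q ∈ Ideal.span (Set.range g))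
    (hg : ∀ i, (g i).IsHomogeneous d)
    (hδ : ∀ j, IsHomogeneousOfDegree (φ (Pi.single j 1)) (δ j)) (j : Fin r) : δ j = d := by
  have h0 := (hδ j).nonneg (map_single_ne_zero hφ j)
  by_contra h
  obtain ⟨a, ha⟩ := (Ideal.mem_span_range_iff_exists_fun).mp ((hrange _).mp ⟨Pi.single j 1, rfl⟩)
  refine map_single_ne_sum hφ (fun i => (hrange _).mpr (Ideal.subset_span ⟨i, rfl⟩))
    (fun i => ?_) j (eq_sum_shiftedComponent_mul (hδ j).toNat hg ha.symm)
  exact constantCoeff_shiftedComponent_of_ne (by omega) _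

/-- Two minimal systems of generators in the same degree differ by an invertible matrix of
constants. -/
lemma exists_linearEquiv_of_minimal (hφ : ∀ w, φ w = 0 → ∀ k, constantCoeff (w k) = 0)
    (hrange : ∀ q, (∃ w, φ w = q) ↔ q ∈ Ideal.span (Set.range g))
    (hg : ∀ i, (g i).IsHomogeneous d) (hli : LinearIndependent K g)
    (hδ : ∀ j, (φ (Pi.single j 1)).IsHomogeneous d) :
    ∃ (A : Matrix ι (Fin r) K)
      (Ψ : (Fin r → MvPolynomial σ K) ≃ₗ[MvPolynomial σ K] (ι → MvPolynomial σ K)),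
      (∀ u i, Ψ u i = ∑ k, C (A i k) * u k) ∧ ∀ u, φ u = ∑ i, Ψ u i * g i := by
  classical
  have h1 : ∀ j, ∃ c : ι → K, φ (Pi.single j 1) = ∑ i, C (c i) * g i := by
    intro j
    obtain ⟨a, ha⟩ :=
      (Ideal.mem_span_range_iff_exists_fun).mp ((hrange _).mp ⟨Pi.single j 1, rfl⟩)
    refine ⟨fun i => constantCoeff (a i), ?_⟩
    simpa only [shiftedComponent_self] using eq_sum_shiftedComponent_mul (hδ j) hg ha.symm
  have h2 : ∀ i, ∃ c : Fin r → K, g i = ∑ j, C (c j) * φ (Pi.single j 1) := by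
    intro i
    obtain ⟨w, hw⟩ := (hrange _).mpr (Ideal.subset_span ⟨i, rfl⟩)
    refine ⟨fun j => constantCoeff (w j), ?_⟩
    rw [map_eq_sum_smul w] at hw
    simpa only [shiftedComponent_self] using eq_sum_shiftedComponent_mul (hg i) hδ hw.symm
  choose c hc using h1
  choose w hw using h2
  let A : Matrix ι (Fin r) K := Matrix.of fun i j => c j i
  let B : Matrix (Fin r) ι K := Matrix.of fun j i => w i j
  have hAB : A * B = 1 := by
    ext s i
    have h3 : ∑ t, ((A * B) t i - (1 : Matrix ι ι K) t i) • g t = 0 := by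
      have h4 : ∑ t, (1 : Matrix ι ι K) t i • g t = g i := by simp [Matrix.one_apply]
      simp only [sub_smul, Finset.sum_sub_distrib]
      rw [h4, sub_eq_zero]
      conv_rhs => rw [hw i]
      simp only [hc, Finset.mul_sum, Matrix.mul_apply, A, B, Matrix.of_apply, Finset.sum_smul]
      rw [Finset.sum_comm]
      refine Finset.sum_congr rfl fun j _ => Finset.sum_congr rfl fun t _ => ?_
      rw [smul_eq_C_mul, C_mul]
      ring
    exact sub_eq_zero.mp (Fintype.linearIndependent_iff.mp hli _ h3 s)
  have hBA : B * A = 1 := by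
    ext k j
    have h3 : φ (fun k => C ((B * A) k j)) = φ (Pi.single j 1) := by
      rw [map_eq_sum_smul, hc j]
      simp only [Matrix.mul_apply, A, B, Matrix.of_apply, map_sum, C_mul, Finset.sum_smul]
      rw [Finset.sum_comm]
      refine Finset.sum_congr rfl fun i _ => ?_
      rw [hw i, Finset.mul_sum]
      refine Finset.sum_congr rfl fun t _ => ?_
      rw [smul_eq_mul]
      ring
    have h4 := constantCoeff_eq_of_map_eq hφ h3 k
    rw [constantCoeff_C] at h4
    rw [h4, Matrix.one_apply]
  let A' : Matrix ι (Fin r) (MvPolynomial σ K) := A.map C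
  let B' : Matrix (Fin r) ι (MvPolynomial σ K) := B.map C
  have hAB' : A' * B' = 1 := by
    rw [← Matrix.map_mul, hAB, Matrix.map_one _ C_0 C_1]
  have hBA' : B' * A' = 1 := by
    rw [← Matrix.map_mul, hBA, Matrix.map_one _ C_0 C_1]
  refine ⟨A, Matrix.toLin'OfInv hBA' hAB', fun u i => rfl, fun u => ?_⟩
  rw [map_eq_sum_smul u]
  have h5 : ∀ i, Matrix.toLin'OfInv hBA' hAB' u i = ∑ k, C (A i k) * u k := fun i => rfl
  simp only [h5, hc, Finset.smul_sum, Finset.sum_mul]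
  rw [Finset.sum_comm]
  refine Finset.sum_congr rfl fun i _ => Finset.sum_congr rfl fun k _ => ?_
  simp only [smul_eq_mul, A, Matrix.of_apply]
  ring

end EqualDegrees

/-! ### The resolution of the Milnor algebra of a free hypersurface -/

section BettiRows

variable {σ K : Type*} [Field K]

lemma GradedFreeResolution.IsMinimal.constantCoeff_of_d_eq_zero {I : Ideal (MvPolynomial σ K)}
    {R : GradedFreeResolution I} (hR : R.IsMinimal) (i : ℕ)
    (w : Fin (R.rank (i + 1)) → MvPolynomial σ K) (hw : R.d i w = 0)
    (k : Fin (R.rank (i + 1))) : constantCoeff (w k) = 0 := by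
  obtain ⟨u, rfl⟩ := (R.exact_d i w).mp hw
  rw [map_eq_sum_smul u]
  simp [hR (i + 1)]

lemma GradedFreeResolution.IsMinimal.constantCoeff_of_aug_eq_zero {I : Ideal (MvPolynomial σ K)}
    {R : GradedFreeResolution I} (hR : R.IsMinimal) (w : Fin (R.rank 0) → MvPolynomial σ K)
    (hw : R.aug w = 0) (k : Fin (R.rank 0)) : constantCoeff (w k) = 0 := by
  obtain ⟨u, rfl⟩ := (R.exact_aug w).mp hw
  rw [map_eq_sum_smul u]
  simp [hR 0]

/-- The zeroth module of a minimal resolution of `S ⧸ I` is `S`, and the augmentation is a nonzero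
constant times the projection. -/
lemma GradedFreeResolution.IsMinimal.exists_aug_eq {I : Ideal (MvPolynomial σ K)}
    {R : GradedFreeResolution I} (hR : R.IsMinimal) (hI : I ≠ ⊤) :
    (∀ j, R.deg 0 j = 0) ∧ ∃ (j₀ : Fin (R.rank 0)) (c : K), c ≠ 0 ∧ (∀ j, j = j₀) ∧
      R.aug (Pi.single j₀ 1) = Ideal.Quotient.mk I (C c) := by
  have h1 : ∀ j, R.deg 0 j = 0 ∧ ∃ c : K, c ≠ 0 ∧
      R.aug (Pi.single j 1) = Ideal.Quotient.mk I (C c) := by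
    intro j
    obtain ⟨p, hp, hj⟩ := R.aug_homogeneous j
    obtain ⟨w, hw⟩ := R.aug_surjective (Ideal.Quotient.mk I 1)
    have h2 : R.aug (p • w) = R.aug (Pi.single j 1) := by
      rw [hj, map_smul, hw, ← Ideal.Quotient.mk_eq_mk, ← Ideal.Quotient.mk_eq_mk,
        ← Submodule.Quotient.mk_smul, smul_eq_mul, mul_one]
    have h3 := constantCoeff_eq_of_map_eq hR.constantCoeff_of_aug_eq_zero h2 j
    rw [if_pos rfl, Pi.smul_apply, smul_eq_mul, map_mul] at h3
    have h4 : constantCoeff p ≠ 0 := left_ne_zero_of_mul_eq_one h3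
    rcases hp with rfl | ⟨n, hn, hp⟩
    · exact absurd (map_zero _) h4
    · have h5 : n = 0 := by
        by_contra h5
        exact h4 (hp.coeff_eq_zero (by simpa using Ne.symm h5))
      subst h5
      refine ⟨by simpa using hn.symm, constantCoeff p, h4, ?_⟩
      rw [hj, constantCoeff_eq]
      rw [← totalDegree_zero_iff_isHomogeneous, totalDegree_eq_zero_iff_eq_C] at hp
      rw [← hp]
  refine ⟨fun j => (h1 j).1, ?_⟩
  have hne : Nonempty (Fin (R.rank 0)) := by
    by_contra hne
    rw [not_nonempty_iff] at hne
    obtain ⟨w, hw⟩ := R.aug_surjective (Ideal.Quotient.mk I 1)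
    rw [Subsingleton.elim w 0, map_zero] at hw
    exact hI ((Ideal.eq_top_iff_one I).mpr (Ideal.Quotient.eq_zero_iff_mem.mp hw.symm))
  obtain ⟨j₀⟩ := hne
  obtain ⟨c, hc, hj₀⟩ := (h1 j₀).2
  refine ⟨j₀, c, hc, fun j => ?_, hj₀⟩
  obtain ⟨c', hc', hj⟩ := (h1 j).2
  by_contra hjj
  have h2 : R.aug (C c • Pi.single j 1 - C c' • Pi.single j₀ 1) = 0 := by
    rw [map_sub, map_smul, map_smul, hj, hj₀, ← Ideal.Quotient.mk_eq_mk, ← Ideal.Quotient.mk_eq_mk,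
      ← Submodule.Quotient.mk_smul, ← Submodule.Quotient.mk_smul, smul_eq_mul, smul_eq_mul,
      mul_comm, sub_self]
  have h3 := hR.constantCoeff_of_aug_eq_zero _ h2 j
  simp [hjj, hc] at h3

lemma jacobianIdeal_ne_top {F : MvPolynomial σ K} {d : ℕ} (hd : d ≠ 0)
    (hg : ∀ s, (pderiv s F).IsHomogeneous d) : jacobianIdeal F ≠ ⊤ := by
  intro h
  have h1 : jacobianIdeal F ≤ RingHom.ker (constantCoeff (σ := σ) (R := K)) := by
    rw [jacobianIdeal, Ideal.span_le]
    rintro _ ⟨s, rfl⟩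
    exact (hg s).coeff_eq_zero (by simpa using hd.symm)
  have h2 := h1 (h ▸ Submodule.mem_top : (1 : MvPolynomial σ K) ∈ jacobianIdeal F)
  rw [RingHom.mem_ker, map_one] at h2
  exact one_ne_zero h2

/-- The degrees in a minimal resolution of `S ⧸ J_F` for a free hypersurface: the resolution is
`0 → ⨁ S(-d - eᵢ) → S(-d)ⁿ → S`, with `d` the degree of the partial derivatives and `eᵢ` the
degrees of a basis of the syzygies. -/
theorem GradedFreeResolution.IsMinimal.deg_sub_eq [Fintype σ] {F : MvPolynomial σ K}
    {R : GradedFreeResolution (jacobianIdeal F)} (hR : R.IsMinimal)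
    {d : ℕ} (hd : d ≠ 0) (hg : ∀ s, (pderiv s F).IsHomogeneous d)
    (hc : LinearIndependent K fun s => pderiv s F) {ι : Type*} [Fintype ι]
    (B : Module.Basis ι (MvPolynomial σ K) (jacobianSyzygies F)) {e : ι → ℕ}
    (he : ∀ i s, ((B i : σ → MvPolynomial σ K) s).IsHomogeneous (e i)) (i : ℕ)
    (j : Fin (R.rank i)) :
    R.deg i j - (i : ℤ) = 0 ∨ R.deg i j - (i : ℤ) = d - 1 ∨
      ∃ t, R.deg i j - (i : ℤ) = d + e t - 2 := by
  obtain ⟨hdeg0, j₀, c, hc0, hj₀, haug⟩ := hR.exists_aug_eq (jacobianIdeal_ne_top hd hg)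
  -- `φ` is the first differential, as a map to `S`
  let φ : (Fin (R.rank 1) → MvPolynomial σ K) →ₗ[MvPolynomial σ K] MvPolynomial σ K :=
    LinearMap.proj j₀ ∘ₗ R.d 0
  have hφ0 : ∀ u, φ u = 0 ↔ R.d 0 u = 0 := by
    intro u
    constructor
    · intro h
      ext1 j
      rw [hj₀ j]
      exact h
    · intro h
      simp [φ, h]
  have hφ : ∀ w, φ w = 0 → ∀ k, constantCoeff (w k) = 0 := fun w hw =>
    hR.constantCoeff_of_d_eq_zero 0 w ((hφ0 w).mp hw)
  have hrange : ∀ q, (∃ w, φ w = q) ↔ q ∈ jacobianIdeal F := by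
    intro q
    have h1 : R.aug (Pi.single j₀ q) = Ideal.Quotient.mk _ (q * C c) := by
      rw [show (Pi.single j₀ q : Fin (R.rank 0) → MvPolynomial σ K) = q • Pi.single j₀ 1 by
        rw [← Pi.single_smul, smul_eq_mul, mul_one], map_smul, haug, ← Ideal.Quotient.mk_eq_mk,
        ← Ideal.Quotient.mk_eq_mk, ← Submodule.Quotient.mk_smul, smul_eq_mul]
    have h2 : (∃ w, φ w = q) ↔ R.aug (Pi.single j₀ q) = 0 := by
      rw [R.exact_aug]
      constructor
      · rintro ⟨w, rfl⟩
        refine ⟨w, ?_⟩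
        ext1 j
        rw [hj₀ j]
        simp [φ]
      · rintro ⟨w, hw⟩
        exact ⟨w, by simp [φ, hw]⟩
    rw [h2, h1, Ideal.Quotient.eq_zero_iff_mem]
    have hcu : IsUnit (C c : MvPolynomial σ K) := (isUnit_iff_ne_zero.mpr hc0).map C
    exact Ideal.mul_unit_mem_iff_mem _ hcu
  have hδ : ∀ j, IsHomogeneousOfDegree (φ (Pi.single j 1)) (R.deg 1 j) := by
    intro j
    have := R.d_homogeneous 0 j j₀
    rwa [hdeg0, sub_zero] at this
  have hdeg1 : ∀ j, R.deg 1 j = d := degree_eq_of_minimal hφ hrange hg hδ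
  obtain ⟨A, Ψ, hΨ, hφΨ⟩ := exists_linearEquiv_of_minimal hφ hrange hg hc fun j => by
    simpa [hdeg1] using (hδ j).toNat
  -- `ψ` is the second differential, with values in the syzygies of the partial derivatives
  let ψ : (Fin (R.rank 2) → MvPolynomial σ K) →ₗ[MvPolynomial σ K] (σ → MvPolynomial σ K) :=
    Ψ.toLinearMap ∘ₗ R.d 1
  have hψ : ∀ w, ψ w = 0 → ∀ k, constantCoeff (w k) = 0 := fun w hw =>
    hR.constantCoeff_of_d_eq_zero 1 w (by simpa [ψ] using hw)
  have hψmem : ∀ w, ψ w ∈ jacobianSyzygies F := by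
    intro w
    rw [mem_jacobianSyzygies]
    exact (hφΨ _).symm.trans ((hφ0 _).mpr ((R.exact_d 0 _).mpr ⟨w, rfl⟩))
  have hψsurj : ∀ i, ∃ w, ψ w = (B i : σ → MvPolynomial σ K) := by
    intro i
    have h1 : R.d 0 (Ψ.symm (B i)) = 0 := by
      rw [← hφ0, hφΨ, Ψ.apply_symm_apply]
      exact mem_jacobianSyzygies.mp (B i).2
    obtain ⟨w, hw⟩ := (R.exact_d 0 _).mp h1
    exact ⟨w, by simp [ψ, hw]⟩
  have hψspan : ∀ w, ∃ a : ι → MvPolynomial σ K,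
      ψ w = ∑ i, a i • (B i : σ → MvPolynomial σ K) := by
    intro w
    refine ⟨fun i => B.repr ⟨ψ w, hψmem w⟩ i, ?_⟩
    have := congrArg Subtype.val (B.sum_repr ⟨ψ w, hψmem w⟩)
    rw [Submodule.coe_sum] at this
    exact this.symm
  have hψdeg : ∀ j s, IsHomogeneousOfDegree (ψ (Pi.single j 1) s) (R.deg 2 j - d) := by
    intro j s
    have h1 : ∀ k, IsHomogeneousOfDegree (R.d 1 (Pi.single j 1) k) (R.deg 2 j - d) := fun k => by
      rw [← hdeg1 k]
      exact R.d_homogeneous 1 j k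
    have h2 : ψ (Pi.single j 1) s = ∑ k, C (A s k) * R.d 1 (Pi.single j 1) k := hΨ _ _
    by_cases hneg : 0 ≤ R.deg 2 j - d
    · refine Or.inr ⟨_, Int.toNat_of_nonneg hneg, ?_⟩
      rw [h2]
      exact IsHomogeneous.sum _ _ _ fun k _ => (h1 k).toNat.C_mul _
    · left
      rw [h2]
      refine Finset.sum_eq_zero fun k _ => ?_
      have : R.d 1 (Pi.single j 1) k = 0 := by
        by_contra h
        exact hneg ((h1 k).nonneg h)
      rw [this, mul_zero]
  have hdeg2 : ∀ j, ∃ t, R.deg 2 j = d + e t := by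
    intro j
    obtain ⟨s, hs⟩ : ∃ s, ψ (Pi.single j 1) s ≠ 0 := by
      by_contra! h
      exact map_single_ne_zero hψ j (funext h)
    have h0 := (hψdeg j s).nonneg hs
    by_contra! h
    obtain ⟨a, ha⟩ := hψspan (Pi.single j 1)
    refine map_single_ne_sum hψ hψsurj
      (a := fun i => shiftedComponent (R.deg 2 j - d).toNat (e i) (a i)) (fun i => ?_) j ?_
    · refine constantCoeff_shiftedComponent_of_ne (fun h1 => h i ?_) _
      omega
    · ext1 t
      have := eq_sum_shiftedComponent_mul (hψdeg j t).toNat (fun i => he i t) (a := a)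
        (by rw [ha]; simp)
      simpa using this
  have hli : LinearIndependent (MvPolynomial σ K) fun i => (B i : σ → MvPolynomial σ K) :=
    B.linearIndependent.map' (jacobianSyzygies F).subtype (Submodule.ker_subtype _)
  have hψinj : ∀ u, R.d 1 u = 0 → u = 0 := fun u hu =>
    eq_zero_of_map_eq_zero hψ hψsurj hli (fun j => hψspan _) (by simp [ψ, hu])
  -- no basis vector lies in the kernel of a differential, but the third differential is zero
  have hrank : ∀ i, IsEmpty (Fin (R.rank (i + 3))) := by
    intro i
    induction i with
    | zero =>
      refine ⟨fun j => map_single_ne_zero (hR.constantCoeff_of_d_eq_zero 2) j (hψinj _ ?_)⟩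
      exact (R.exact_d 1 _).mpr ⟨_, rfl⟩
    | succ i ih =>
      exact ⟨fun j => map_single_ne_zero (hR.constantCoeff_of_d_eq_zero (i + 3)) j
        (Subsingleton.elim _ _)⟩
  match i, j with
  | 0, j =>
    left
    rw [hdeg0]
    simp
  | 1, j =>
    right; left
    rw [hdeg1]
    simp
  | 2, j =>
    right; right
    obtain ⟨t, ht⟩ := hdeg2 j
    exact ⟨t, by rw [ht]; simp⟩
  | i + 3, j => exact ((hrank i).false j).elim

/-- The map `S(-d)ⁿ → S` given by the partial derivatives; `ν` numbers the variables. -/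
def gradientMap {n : ℕ} (ν : Fin n ≃ σ) (F : MvPolynomial σ K) :
    (Fin n → MvPolynomial σ K) →ₗ[MvPolynomial σ K] (Fin 1 → MvPolynomial σ K) :=
  LinearMap.pi fun _ => Fintype.linearCombination _ fun k => pderiv (ν k) F

lemma gradientMap_apply {n : ℕ} (ν : Fin n ≃ σ) (F : MvPolynomial σ K)
    (u : Fin n → MvPolynomial σ K) (j : Fin 1) :
    gradientMap ν F u j = ∑ k, u k * pderiv (ν k) F := by
  simp [gradientMap, Fintype.linearCombination_apply]

lemma gradientMap_single {n : ℕ} (ν : Fin n ≃ σ) (F : MvPolynomial σ K) (k : Fin n) (j : Fin 1) :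
    gradientMap ν F (Pi.single k 1) j = pderiv (ν k) F := by
  simp [gradientMap_apply, Pi.single_apply]

lemma gradientMap_exact {n : ℕ} (ν : Fin n ≃ σ) (F : MvPolynomial σ K) :
    Function.Exact (gradientMap ν F)
      ((jacobianIdeal F).mkQ ∘ₗ LinearMap.proj (φ := fun _ => MvPolynomial σ K) (0 : Fin 1)) := by
  intro q
  rw [LinearMap.comp_apply, LinearMap.proj_apply, Submodule.mkQ_apply,
    Submodule.Quotient.mk_eq_zero, jacobianIdeal, ← ν.surjective.range_comp,
    Ideal.mem_span_range_iff_exists_fun]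
  refine exists_congr fun c => ?_
  rw [funext_iff]
  simp [gradientMap_apply]

/-- The inclusion `⨁ S(-d - eᵢ) → S(-d)ⁿ` of the syzygies with basis `B`. -/
def syzygyMap [Fintype σ] {F : MvPolynomial σ K} {n m : ℕ} (ν : Fin n ≃ σ)
    (B : Module.Basis (Fin m) (MvPolynomial σ K) (jacobianSyzygies F)) :
    (Fin m → MvPolynomial σ K) →ₗ[MvPolynomial σ K] (Fin n → MvPolynomial σ K) :=
  Fintype.linearCombination _ fun i k => (B i : σ → MvPolynomial σ K) (ν k)

lemma syzygyMap_apply [Fintype σ] {F : MvPolynomial σ K} {n m : ℕ} (ν : Fin n ≃ σ)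
    (B : Module.Basis (Fin m) (MvPolynomial σ K) (jacobianSyzygies F))
    (u : Fin m → MvPolynomial σ K) (k : Fin n) :
    syzygyMap ν B u k = (B.equivFun.symm u : σ → MvPolynomial σ K) (ν k) := by
  simp [syzygyMap, Fintype.linearCombination_apply, B.equivFun_symm_apply]

lemma syzygyMap_single [Fintype σ] {F : MvPolynomial σ K} {n m : ℕ} (ν : Fin n ≃ σ)
    (B : Module.Basis (Fin m) (MvPolynomial σ K) (jacobianSyzygies F)) (i : Fin m) (k : Fin n) :
    syzygyMap ν B (Pi.single i 1) k = (B i : σ → MvPolynomial σ K) (ν k) := by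
  simp [syzygyMap]

lemma syzygyMap_exact [Fintype σ] {F : MvPolynomial σ K} {n m : ℕ} (ν : Fin n ≃ σ)
    (B : Module.Basis (Fin m) (MvPolynomial σ K) (jacobianSyzygies F)) :
    Function.Exact (syzygyMap ν B) (gradientMap ν F) := by
  intro q
  have h1 : gradientMap ν F q = 0 ↔ (fun s => q (ν.symm s)) ∈ jacobianSyzygies F := by
    rw [mem_jacobianSyzygies, ← ν.sum_comp, funext_iff]
    simp [gradientMap_apply]
  rw [h1]
  constructor
  · intro h
    refine ⟨B.equivFun ⟨_, h⟩, ?_⟩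
    ext1 k
    simp [syzygyMap_apply]
  · rintro ⟨u, rfl⟩
    convert (B.equivFun.symm u).2 using 1
    ext1 s
    simp [syzygyMap_apply]

lemma syzygyMap_injective [Fintype σ] {F : MvPolynomial σ K} {n m : ℕ} (ν : Fin n ≃ σ)
    (B : Module.Basis (Fin m) (MvPolynomial σ K) (jacobianSyzygies F)) :
    Function.Injective (syzygyMap ν B) := by
  intro u v h
  apply B.equivFun.symm.injective
  ext1
  ext1 s
  simpa [syzygyMap_apply] using congrFun h (ν.symm s)

/-- The ranks `1, n, m, 0, 0, …` of the resolution of the Milnor algebra of a free hypersurface. -/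
def freeResolutionRank (n m : ℕ) : ℕ → ℕ
  | 0 => 1
  | 1 => n
  | 2 => m
  | _ => 0

/-- The resolution `0 → ⨁ S(-d - eᵢ) → S(-d)ⁿ → S → S ⧸ J_F → 0` given by a homogeneous basis of the
syzygies of a free hypersurface. -/
def freeResolution [Fintype σ] {F : MvPolynomial σ K} {n m d : ℕ} (ν : Fin n ≃ σ)
    (hg : ∀ s, (pderiv s F).IsHomogeneous d)
    (B : Module.Basis (Fin m) (MvPolynomial σ K) (jacobianSyzygies F)) {e : Fin m → ℕ}
    (he : ∀ i s, ((B i : σ → MvPolynomial σ K) s).IsHomogeneous (e i)) :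
    GradedFreeResolution (jacobianIdeal F) where
  rank := freeResolutionRank n m
  deg
    | 0 => fun _ => 0
    | 1 => fun _ => d
    | 2 => fun i => d + e i
    | _ + 3 => fun _ => 0
  aug := (jacobianIdeal F).mkQ ∘ₗ LinearMap.proj (φ := fun _ => MvPolynomial σ K) (0 : Fin 1)
  d
    | 0 => gradientMap ν F
    | 1 => syzygyMap ν B
    | _ + 2 => 0
  aug_homogeneous := by
    intro j
    refine ⟨1, Or.inr ⟨0, rfl, isHomogeneous_one _ _⟩, ?_⟩
    rw [Subsingleton.elim (α := Fin 1) j 0]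
    simp
    rfl
  d_homogeneous
    | 0, j, k => by
      refine Or.inr ⟨d, by simp, ?_⟩
      exact (gradientMap_single ν F j k).symm ▸ hg (ν j)
    | 1, j, k => by
      refine Or.inr ⟨e j, by simp, ?_⟩
      exact (syzygyMap_single ν B j k).symm ▸ he j (ν k)
    | i + 2, j, k => Or.inl (by simp)
  aug_surjective := by
    intro q
    obtain ⟨p, rfl⟩ := (jacobianIdeal F).mkQ_surjective q
    exact ⟨fun _ => p, rfl⟩
  exact_aug := gradientMap_exact ν F
  exact_d
    | 0 => syzygyMap_exact ν B
    | 1 => by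
      intro q
      have h1 : syzygyMap ν B q = 0 ↔ q = 0 :=
        (syzygyMap_injective ν B).eq_iff' (map_zero _)
      refine h1.trans ⟨fun h => ⟨0, h.symm⟩, ?_⟩
      rintro ⟨u, rfl⟩
      rfl
    | i + 2 => by
      intro q
      exact ⟨fun _ => ⟨0, Subsingleton.elim (α := Fin 0 → MvPolynomial σ K) _ _⟩, fun _ => rfl⟩

lemma freeResolution_isMinimal [Fintype σ] {F : MvPolynomial σ K} {n m d : ℕ} (ν : Fin n ≃ σ)
    (hg : ∀ s, (pderiv s F).IsHomogeneous d)
    (B : Module.Basis (Fin m) (MvPolynomial σ K) (jacobianSyzygies F)) {e : Fin m → ℕ}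
    (he : ∀ i s, ((B i : σ → MvPolynomial σ K) s).IsHomogeneous (e i)) (hd : d ≠ 0)
    (he0 : ∀ i, e i ≠ 0) : (freeResolution ν hg B he).IsMinimal
  | 0, j, k => (congrArg constantCoeff (gradientMap_single ν F j k)).trans
      ((hg (ν j)).coeff_eq_zero (by simpa using hd.symm))
  | 1, j, k => (congrArg constantCoeff (syzygyMap_single ν B j k)).trans
      ((he j (ν k)).coeff_eq_zero (by simpa using (he0 j).symm))
  | _ + 2, j, _ => Fin.elim0 j

/-- The regularity of the Milnor algebra of a free hypersurface of degree `d + 1` whose syzygies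
are generated in degrees `eᵢ` is `d - 2` plus the largest `eᵢ`. -/
theorem hasRegularity_jacobianIdeal [Fintype σ] {F : MvPolynomial σ K} {m d : ℕ}
    (hg : ∀ s, (pderiv s F).IsHomogeneous d) (hc : LinearIndependent K fun s => pderiv s F)
    (B : Module.Basis (Fin m) (MvPolynomial σ K) (jacobianSyzygies F)) {e : Fin m → ℕ}
    (he : ∀ i s, ((B i : σ → MvPolynomial σ K) s).IsHomogeneous (e i)) (hd : d ≠ 0)
    (he0 : ∀ i, e i ≠ 0) (i₀ : Fin m) (hmax : ∀ i, e i ≤ e i₀) :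
    HasRegularity (jacobianIdeal F) (d + e i₀ - 2) := by
  have h0 := he0 i₀
  constructor
  · exact ⟨_, freeResolution_isMinimal (Fintype.equivFin σ).symm hg B he hd he0, 2, i₀, rfl⟩
  · rintro r ⟨R, hR, i, j, rfl⟩
    rcases hR.deg_sub_eq hd hg hc B he i j with h | h | ⟨t, h⟩
    · omega
    · omega
    · have := hmax t
      omega

end BettiRows

/-! ### The maximal minors are squarefree and pairwise coprime -/

section Minors

variable {K : Type*} [Field K]

lemma degreeOf_eq_zero_of_dvd {σ : Type*} {f p : MvPolynomial σ K} {T : Set σ} (hf : f ≠ 0)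
    (hT : f ∈ supported K T) (hp : p ∣ f) {s : σ} (hs : s ∉ T) : degreeOf s p = 0 := by
  obtain ⟨q, rfl⟩ := hp
  have h1 := degreeOf_mul_eq (n := s) (left_ne_zero_of_mul hf) (right_ne_zero_of_mul hf)
  have h2 : degreeOf s (p * q) = 0 := by
    by_contra h
    have h3 := mem_supported.mp hT
    classical
    refine hs (h3 (Finset.mem_coe.mpr ?_))
    rw [vars_def, Multiset.mem_toFinset, ← Multiset.count_pos, ← degreeOf_def]
    exact Nat.pos_of_ne_zero h
  omega

lemma pderiv_eq_zero_of_degreeOf_eq_zero {σ : Type*} {p : MvPolynomial σ K} {s : σ}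
    (h : degreeOf s p = 0) : pderiv s p = 0 := by
  by_contra h1
  have := degreeOf_pderiv_lt h1
  omega

lemma isUnit_of_forall_degreeOf_eq_zero {σ : Type*} {p : MvPolynomial σ K} (hp : p ≠ 0)
    (h : ∀ s, degreeOf s p = 0) : IsUnit p := by
  have h1 : p = C (coeff 0 p) := by
    rw [← totalDegree_eq_zero_iff_eq_C, totalDegree_eq_zero_iff]
    intro m hm s
    have := monomial_le_degreeOf s hm
    rw [h] at this
    omega
  have h2 : coeff 0 p ≠ 0 := by
    intro h2
    rw [h2, C_0] at h1
    exact hp h1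
  rw [h1]
  exact (isUnit_iff_ne_zero.mpr h2).map C

/-- The `2`-minor on the rows `r, s` and the columns `b, c`. -/
def minorTwo (K : Type*) [Field K] (r s : Fin 3) (b c : Fin 5) : MvPolynomial (Fin 3 × Fin 5) K :=
  X (r, b) * X (s, c) - X (r, c) * X (s, b)

lemma minorTwo_ne_zero {r s : Fin 3} {b c : Fin 5} (hbc : b ≠ c) (hrs : r ≠ s) :
    minorTwo K r s b c ≠ 0 := by
  intro h
  have h1 := congrArg (pderiv (r, b)) h
  simp [minorTwo, pderiv_X, hbc.symm, hrs.symm] at h1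

lemma minorTwo_mem_supported (r s : Fin 3) (b c : Fin 5) :
    minorTwo K r s b c ∈ supported K {t | t.1 = r ∨ t.1 = s} := by
  have h1 : ∀ j, (X (r, j) : MvPolynomial (Fin 3 × Fin 5) K)
      ∈ supported K {t | t.1 = r ∨ t.1 = s} := fun j => X_mem_supported.mpr (Or.inl rfl)
  have h2 : ∀ j, (X (s, j) : MvPolynomial (Fin 3 × Fin 5) K)
      ∈ supported K {t | t.1 = r ∨ t.1 = s} := fun j => X_mem_supported.mpr (Or.inr rfl)
  exact sub_mem (mul_mem (h1 _) (h2 _)) (mul_mem (h1 _) (h2 _))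

/-- A common divisor of the three `2`-minors of two columns involves no row of variables. -/
lemma isUnit_of_dvd_minorTwo {b c : Fin 5} (hbc : b ≠ c) {q : MvPolynomial (Fin 3 × Fin 5) K}
    (h0 : q ∣ minorTwo K 1 2 b c) (h1 : q ∣ minorTwo K 0 2 b c) (h2 : q ∣ minorTwo K 0 1 b c) :
    IsUnit q := by
  have hne := minorTwo_ne_zero (K := K) (r := 1) (s := 2) hbc (by decide)
  refine isUnit_of_forall_degreeOf_eq_zero (ne_zero_of_dvd_ne_zero hne h0) ?_
  rintro ⟨r, j⟩
  fin_cases r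
  · exact degreeOf_eq_zero_of_dvd hne (minorTwo_mem_supported _ _ _ _) h0 (by simp)
  · exact degreeOf_eq_zero_of_dvd (minorTwo_ne_zero hbc (by decide))
      (minorTwo_mem_supported _ _ _ _) h1 (by simp)
  · exact degreeOf_eq_zero_of_dvd (minorTwo_ne_zero hbc (by decide))
      (minorTwo_mem_supported _ _ _ _) h2 (by simp)

lemma genericMinor_eq (a b c : Fin 5) : genericMinor K a b c =
    X (0, a) * minorTwo K 1 2 b c - X (1, a) * minorTwo K 0 2 b c
      + X (2, a) * minorTwo K 0 1 b c := by
  rw [genericMinor, Matrix.det_fin_three]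
  simp [minorTwo]
  ring

lemma genericMinor_rotate (a b c : Fin 5) : genericMinor K a b c = genericMinor K b c a := by
  simp only [genericMinor_eq, minorTwo]
  ring

lemma genericMinor_swap (a b c : Fin 5) : genericMinor K a b c = -genericMinor K b a c := by
  simp only [genericMinor_eq, minorTwo]
  ring

lemma genericMinor_mem_supported {a b c : Fin 5} {T : Set (Fin 3 × Fin 5)}
    (hT : ∀ r, (r, a) ∈ T ∧ (r, b) ∈ T ∧ (r, c) ∈ T) : genericMinor K a b c ∈ supported K T := by
  have ha : ∀ r, (X (r, a) : MvPolynomial (Fin 3 × Fin 5) K) ∈ supported K T :=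
    fun r => X_mem_supported.mpr (hT r).1
  have hb : ∀ r, (X (r, b) : MvPolynomial (Fin 3 × Fin 5) K) ∈ supported K T :=
    fun r => X_mem_supported.mpr (hT r).2.1
  have hc : ∀ r, (X (r, c) : MvPolynomial (Fin 3 × Fin 5) K) ∈ supported K T :=
    fun r => X_mem_supported.mpr (hT r).2.2
  rw [genericMinor_eq]
  simp only [minorTwo]
  exact add_mem (sub_mem (mul_mem (ha _) (sub_mem (mul_mem (hb _) (hc _)) (mul_mem (hc _) (hb _))))
    (mul_mem (ha _) (sub_mem (mul_mem (hb _) (hc _)) (mul_mem (hc _) (hb _)))))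
    (mul_mem (ha _) (sub_mem (mul_mem (hb _) (hc _)) (mul_mem (hc _) (hb _))))

lemma pderiv_genericMinor {a b c : Fin 5} (hab : a ≠ b) (hac : a ≠ c) (r : Fin 3) :
    pderiv (r, a) (genericMinor K a b c) =
      ![minorTwo K 1 2 b c, -minorTwo K 0 2 b c, minorTwo K 0 1 b c] r := by
  have h : ∀ r s t, pderiv (r, a) (minorTwo K s t b c) = 0 := fun r s t => by
    simp [minorTwo, pderiv_X, hab.symm, hac.symm]
  rw [genericMinor_eq]
  fin_cases r <;>
    simp [pderiv_X, h]

lemma isUnit_of_dvd_pderiv_genericMinor {a b c : Fin 5} (hab : a ≠ b) (hac : a ≠ c) (hbc : b ≠ c)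
    {q : MvPolynomial (Fin 3 × Fin 5) K} (h : ∀ r, q ∣ pderiv (r, a) (genericMinor K a b c)) :
    IsUnit q := by
  simp only [pderiv_genericMinor hab hac] at h
  exact isUnit_of_dvd_minorTwo hbc (h 0) ((dvd_neg).mp (h 1)) (h 2)

lemma genericMinor_ne_zero {a b c : Fin 5} (hab : a ≠ b) (hac : a ≠ c) (hbc : b ≠ c) :
    genericMinor K a b c ≠ 0 := by
  intro h
  have h1 := pderiv_genericMinor (K := K) hab hac 0
  rw [h, map_zero] at h1
  exact minorTwo_ne_zero hbc (by decide) h1.symm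

lemma squarefree_genericMinor {a b c : Fin 5} (hab : a ≠ b) (hac : a ≠ c) (hbc : b ≠ c) :
    Squarefree (genericMinor K a b c) := by
  rintro q ⟨g, hg⟩
  refine isUnit_of_dvd_pderiv_genericMinor hab hac hbc fun r => ?_
  rw [hg, pderiv_mul, pderiv_mul]
  exact ⟨pderiv (r, a) q * g + pderiv (r, a) q * g + q * pderiv (r, a) g, by ring⟩

/-- A common divisor of `Δ_{abc}` and of a minor without the column `a` involves no variable of that
column, so it divides the derivatives of `Δ_{abc}` with respect to these variables. -/
lemma isRelPrime_genericMinor {a b c a' b' c' : Fin 5} (hab : a ≠ b) (hac : a ≠ c) (hbc : b ≠ c)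
    (hab' : a' ≠ b') (hac' : a' ≠ c') (hbc' : b' ≠ c') (h1 : a ≠ a') (h2 : a ≠ b') (h3 : a ≠ c') :
    IsRelPrime (genericMinor K a b c) (genericMinor K a' b' c') := by
  rintro q ⟨g, hg⟩ hq'
  refine isUnit_of_dvd_pderiv_genericMinor hab hac hbc fun r => ?_
  have h4 : degreeOf (r, a) q = 0 :=
    degreeOf_eq_zero_of_dvd (T := {t : Fin 3 × Fin 5 | t.2 ≠ a}) (genericMinor_ne_zero hab' hac' hbc')
      (genericMinor_mem_supported fun r => ⟨h1.symm, h2.symm, h3.symm⟩) hq' (by simp)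
  rw [hg, pderiv_mul, pderiv_eq_zero_of_degreeOf_eq_zero h4, zero_mul, zero_add]
  exact dvd_mul_right _ _

lemma isHomogeneous_genericMinor (a b c : Fin 5) : (genericMinor K a b c).IsHomogeneous 3 := by
  have h : ∀ r s, (minorTwo K r s b c).IsHomogeneous 2 := fun r s =>
    ((isHomogeneous_X K _).mul (isHomogeneous_X K _)).sub
      ((isHomogeneous_X K _).mul (isHomogeneous_X K _))
  rw [genericMinor_eq]
  exact (((isHomogeneous_X K _).mul (h _ _)).sub ((isHomogeneous_X K _).mul (h _ _))).add
    ((isHomogeneous_X K _).mul (h _ _))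

/-- The product of the minors on the columns `abc, abd, acd, bcd, abe, ace`, where `a, …, e` are the
columns `0, …, 4` rearranged by `τ`. -/
def minorProduct (K : Type*) [Field K] (τ : Equiv.Perm (Fin 5)) : MvPolynomial (Fin 3 × Fin 5) K :=
  genericMinor K (τ 0) (τ 1) (τ 2) * genericMinor K (τ 0) (τ 1) (τ 3) *
    genericMinor K (τ 0) (τ 2) (τ 3) * genericMinor K (τ 1) (τ 2) (τ 3) *
    genericMinor K (τ 0) (τ 1) (τ 4) * genericMinor K (τ 0) (τ 2) (τ 4)

lemma isHomogeneous_minorProduct (τ : Equiv.Perm (Fin 5)) :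
    (minorProduct K τ).IsHomogeneous 18 :=
  (((((isHomogeneous_genericMinor _ _ _).mul (isHomogeneous_genericMinor _ _ _)).mul
    (isHomogeneous_genericMinor _ _ _)).mul (isHomogeneous_genericMinor _ _ _)).mul
    (isHomogeneous_genericMinor _ _ _)).mul (isHomogeneous_genericMinor _ _ _)

lemma squarefree_minorProduct (τ : Equiv.Perm (Fin 5)) : Squarefree (minorProduct K τ) := by
  have hne : ∀ {i j : Fin 5}, i ≠ j → τ i ≠ τ j := fun h => τ.injective.ne h
  have hsq : ∀ {i j k : Fin 5}, i ≠ j → i ≠ k → j ≠ k →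
      Squarefree (genericMinor K (τ i) (τ j) (τ k)) := fun h1 h2 h3 =>
    squarefree_genericMinor (hne h1) (hne h2) (hne h3)
  -- two triples of columns are separated by the first, second or third column of the first triple
  have hr : ∀ i j k i' j' k' : Fin 5, (i ≠ j ∧ i ≠ k ∧ j ≠ k ∧ i' ≠ j' ∧ i' ≠ k' ∧ j' ≠ k') ∧
      ((i ≠ i' ∧ i ≠ j' ∧ i ≠ k') ∨ (j ≠ i' ∧ j ≠ j' ∧ j ≠ k') ∨ (k ≠ i' ∧ k ≠ j' ∧ k ≠ k')) →
      IsRelPrime (genericMinor K (τ i) (τ j) (τ k)) (genericMinor K (τ i') (τ j') (τ k')) := by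
    rintro i j k i' j' k' ⟨⟨h1, h2, h3, h4, h5, h6⟩, ⟨h7, h8, h9⟩ | ⟨h7, h8, h9⟩ | ⟨h7, h8, h9⟩⟩
    · exact isRelPrime_genericMinor (hne h1) (hne h2) (hne h3) (hne h4) (hne h5) (hne h6)
        (hne h7) (hne h8) (hne h9)
    · rw [genericMinor_rotate]
      exact isRelPrime_genericMinor (hne h3) (hne h1.symm) (hne h2.symm) (hne h4) (hne h5)
        (hne h6) (hne h7) (hne h8) (hne h9)
    · rw [genericMinor_rotate, genericMinor_rotate]
      exact isRelPrime_genericMinor (hne h2.symm) (hne h3.symm) (hne h1) (hne h4) (hne h5)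
        (hne h6) (hne h7) (hne h8) (hne h9)
  simp only [minorProduct, squarefree_mul_iff, IsRelPrime.mul_left_iff]
  refine ⟨?_, ⟨?_, ⟨?_, ⟨?_, ⟨?_, ?_, ?_⟩, ?_⟩, ?_⟩, ?_⟩, ?_⟩
  case refine_1 =>
    refine ⟨⟨⟨⟨?_, ?_⟩, ?_⟩, ?_⟩, ?_⟩ <;> exact hr _ _ _ _ _ _ (by decide)
  case refine_2 =>
    refine ⟨⟨⟨?_, ?_⟩, ?_⟩, ?_⟩ <;> exact hr _ _ _ _ _ _ (by decide)
  case refine_3 =>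
    refine ⟨⟨?_, ?_⟩, ?_⟩ <;> exact hr _ _ _ _ _ _ (by decide)
  case refine_4 =>
    refine ⟨?_, ?_⟩ <;> exact hr _ _ _ _ _ _ (by decide)
  case refine_5 => exact hr _ _ _ _ _ _ (by decide)
  all_goals exact hsq (by decide) (by decide) (by decide)

end Minors

/-! ### Logarithmic vector fields of the products of minors -/

section Fields

lemma mkDerivation_eq_sum {σ K : Type*} [Fintype σ] [Field K] (θ : σ → MvPolynomial σ K)
    (F : MvPolynomial σ K) : mkDerivation K θ F = ∑ s, θ s * pderiv s F := by
  have h : mkDerivation K θ = ∑ s, θ s • pderiv s := by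
    classical
    refine derivation_ext fun i => ?_
    rw [mkDerivation_X, ← Derivation.coeFnAddMonoidHom_apply, map_sum, Finset.sum_apply]
    simp [pderiv_X, Pi.single_apply]
  rw [h, ← Derivation.coeFnAddMonoidHom_apply, map_sum, Finset.sum_apply]
  simp

/-- Saito's criterion for logarithmic vector fields `θᵢ`, with `θᵢ F = gᵢ F`: subtracting the multiple
`gᵢ / D` of the Euler field makes them syzygies. Independence is tested at a point. -/
theorem exists_basis_jacobianSyzygies_of_logarithmic {σ K : Type*} [Fintype σ] [Field K]
    [CharZero K] {F : MvPolynomial σ K} {D : ℕ}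
    (hF : F.IsHomogeneous D) (hD : D ≠ 0) (hsq : Squarefree F) {ι : Type*} [Fintype ι]
    (hcard : Fintype.card ι + 1 = Fintype.card σ)
    {θ : ι → σ → MvPolynomial σ K} {g : ι → MvPolynomial σ K}
    (hθ : ∀ i, mkDerivation K (θ i) F = g i * F) {e : ι → ℕ}
    (he : ∀ i s, (θ i s).IsHomogeneous (e i + 1)) (hg : ∀ i, (g i).IsHomogeneous (e i))
    (hsum : ∑ i, (e i + 1) + 1 = D) (P : σ → K)
    (hP : ∀ (c₀ : K) (c : ι → K), (∀ s, c₀ * P s + ∑ i, c i * eval P (θ i s) = 0) →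
      c₀ = 0 ∧ ∀ i, c i = 0) :
    ∃ B : Module.Basis ι (MvPolynomial σ K) (jacobianSyzygies F),
      ∀ i s, ((B i : σ → MvPolynomial σ K) s).IsHomogeneous (e i + 1) := by
  classical
  have hD' : (D : K) ≠ 0 := Nat.cast_ne_zero.mpr hD
  obtain ⟨ε⟩ : Nonempty (Option ι ≃ σ) := by
    rw [← Fintype.card_eq, Fintype.card_option, hcard]
  let b : ι → σ → MvPolynomial σ K := fun i s => θ i s - C (D : K)⁻¹ * g i * X s
  have hb : ∀ i, b i ∈ jacobianSyzygies F := by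
    intro i
    have h1 := hF.sum_X_mul_pderiv
    have h2 := hθ i
    rw [mkDerivation_eq_sum] at h2
    rw [mem_jacobianSyzygies]
    simp only [b, sub_mul, Finset.sum_sub_distrib, mul_assoc _ (X _), ← Finset.mul_sum, h1, h2]
    rw [nsmul_eq_mul, ← map_natCast (C (σ := σ) (R := K)) D]
    have h3 : (C (D : K)⁻¹ * C (D : K) : MvPolynomial σ K) = 1 := by
      rw [← C_mul, inv_mul_cancel₀ hD', C_1]
    linear_combination -g i * F * h3
  have hbe : ∀ i s, (b i s).IsHomogeneous (e i + 1) := fun i s =>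
    (he i s).sub (((hg i).C_mul _).mul (isHomogeneous_X K s))
  have hdet : (borderedMatrix ε X b).det ≠ 0 := by
    intro h0
    have h1 : (eval P).mapMatrix (borderedMatrix ε X b)
        = borderedMatrix ε P fun i s => eval P (b i s) := by
      ext i t
      obtain ⟨j, rfl⟩ := ε.surjective i
      cases j with
      | none => rw [RingHom.mapMatrix_apply, Matrix.map_apply, borderedMatrix_none,
          borderedMatrix_none, eval_X]
      | some j => rw [RingHom.mapMatrix_apply, Matrix.map_apply, borderedMatrix_some,
          borderedMatrix_some]
    have h2 := congrArg (eval P) h0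
    rw [RingHom.map_det, h1, map_zero] at h2
    refine (linearIndependent_borderedMatrix_iff ε P fun i s => eval P (b i s)).mpr ?_ h2
    rw [Fintype.linearIndependent_iff]
    intro c hc
    obtain ⟨h3, h4⟩ := hP (c none - ∑ i, c (some i) * ((D : K)⁻¹ * eval P (g i)))
      (fun i => c (some i)) fun s => by
        have h5 := congrFun hc s
        simp only [Fintype.sum_option, Option.elim_none, Option.elim_some,
          Pi.smul_apply, Finset.sum_apply, smul_eq_mul, b, map_sub, map_mul, eval_C, eval_X,
          Pi.zero_apply, mul_sub, Finset.sum_sub_distrib] at h5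
        rw [sub_mul, Finset.sum_mul, ← h5]
        simp only [mul_assoc]
        ring
    rintro (_ | i)
    · simpa [h4] using h3
    · exact h4 i
  obtain ⟨B, hB⟩ := exists_basis_jacobianSyzygies hF hD hsq ε hb hbe hsum hdet
  exact ⟨B, fun i s => by rw [hB]; exact hbe i s⟩

variable {K : Type*} [Field K]

/-- The linear vector field which moves the row `r` of the generic matrix along the row `s`. -/
def rowField (K : Type*) [Field K] (r s : Fin 3) : Fin 3 × Fin 5 → MvPolynomial (Fin 3 × Fin 5) K :=
  fun t => if t.1 = r then X (s, t.2) else 0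

/-- The vector field which moves the column `j` of the generic matrix along `w`. -/
def columnField (j : Fin 5) (w : Fin 3 → MvPolynomial (Fin 3 × Fin 5) K) :
    Fin 3 × Fin 5 → MvPolynomial (Fin 3 × Fin 5) K :=
  fun t => if t.2 = j then w t.1 else 0

lemma mkDerivation_rowField_genericMinor (r s : Fin 3) (a b c : Fin 5) :
    mkDerivation K (rowField K r s) (genericMinor K a b c)
      = (if r = s then 1 else 0) * genericMinor K a b c := by
  simp only [genericMinor_eq, minorTwo, map_add, map_sub, Derivation.leibniz, mkDerivation_X,
    rowField, smul_eq_mul]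
  fin_cases r <;> fin_cases s <;> simp <;> ring

/-- The determinant of the columns `u, v, w`. -/
def columnDet {R : Type*} [CommRing R] (u v w : Fin 3 → R) : R :=
  u 0 * (v 1 * w 2 - w 1 * v 2) - u 1 * (v 0 * w 2 - w 0 * v 2) + u 2 * (v 0 * w 1 - w 0 * v 1)

lemma mkDerivation_genericMinor (θ : Fin 3 × Fin 5 → MvPolynomial (Fin 3 × Fin 5) K)
    (a b c : Fin 5) :
    mkDerivation K θ (genericMinor K a b c) =
      columnDet (fun r => θ (r, a)) (fun r => X (r, b)) (fun r => X (r, c)) +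
      columnDet (fun r => X (r, a)) (fun r => θ (r, b)) (fun r => X (r, c)) +
      columnDet (fun r => X (r, a)) (fun r => X (r, b)) (fun r => θ (r, c)) := by
  simp only [genericMinor_eq, minorTwo, map_add, map_sub, Derivation.leibniz, mkDerivation_X,
    smul_eq_mul, columnDet]
  ring

/-- Logarithmic vector fields of the product of minors: eight row operations, the scalings of four
columns and the field moving the column `e` along the column `a`, which all have linear
coefficients, and the field moving the column `e` along `Δ_{ace}` times the column `b`. The field
`rowField K 2 2` and the scaling of the column `d` are left out: they depend on the others and the
Euler field. -/
def logField (K : Type*) [Field K] (τ : Equiv.Perm (Fin 5)) :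
    Fin 14 → Fin 3 × Fin 5 → MvPolynomial (Fin 3 × Fin 5) K :=
  ![rowField K 0 0, rowField K 0 1, rowField K 0 2, rowField K 1 0, rowField K 1 1, rowField K 1 2,
    rowField K 2 0, rowField K 2 1,
    columnField (τ 0) fun r => X (r, τ 0), columnField (τ 1) fun r => X (r, τ 1),
    columnField (τ 2) fun r => X (r, τ 2), columnField (τ 4) fun r => X (r, τ 4),
    columnField (τ 4) fun r => X (r, τ 0),
    columnField (τ 4) fun r => genericMinor K (τ 0) (τ 2) (τ 4) * X (r, τ 1)]

/-- The factors `g` with `θ F = g F` for the logarithmic vector fields `θ`. -/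
def logFactor (K : Type*) [Field K] (τ : Equiv.Perm (Fin 5)) :
    Fin 14 → MvPolynomial (Fin 3 × Fin 5) K :=
  ![C 6, 0, 0, 0, C 6, 0, 0, 0, C 5, C 4, C 4, C 2, 0, -genericMinor K (τ 0) (τ 1) (τ 2)]

/-- The degrees of the coefficients of the logarithmic vector fields, minus one. -/
def logDegree : Fin 14 → ℕ := ![0, 0, 0, 0, 0, 0, 0, 0, 0, 0, 0, 0, 0, 3]

lemma mkDerivation_minorProduct {τ : Equiv.Perm (Fin 5)}
    {θ : Fin 3 × Fin 5 → MvPolynomial (Fin 3 × Fin 5) K}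
    {g₁ g₂ g₃ g₄ g₅ g₆ : MvPolynomial (Fin 3 × Fin 5) K}
    (h₁ : mkDerivation K θ (genericMinor K (τ 0) (τ 1) (τ 2))
      = g₁ * genericMinor K (τ 0) (τ 1) (τ 2))
    (h₂ : mkDerivation K θ (genericMinor K (τ 0) (τ 1) (τ 3))
      = g₂ * genericMinor K (τ 0) (τ 1) (τ 3))
    (h₃ : mkDerivation K θ (genericMinor K (τ 0) (τ 2) (τ 3))
      = g₃ * genericMinor K (τ 0) (τ 2) (τ 3))
    (h₄ : mkDerivation K θ (genericMinor K (τ 1) (τ 2) (τ 3))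
      = g₄ * genericMinor K (τ 1) (τ 2) (τ 3))
    (h₅ : mkDerivation K θ (genericMinor K (τ 0) (τ 1) (τ 4))
      = g₅ * genericMinor K (τ 0) (τ 1) (τ 4))
    (h₆ : mkDerivation K θ (genericMinor K (τ 0) (τ 2) (τ 4))
      = g₆ * genericMinor K (τ 0) (τ 2) (τ 4)) :
    mkDerivation K θ (minorProduct K τ) = (g₁ + g₂ + g₃ + g₄ + g₅ + g₆) * minorProduct K τ := by
  simp only [minorProduct, Derivation.leibniz, h₁, h₂, h₃, h₄, h₅, h₆, smul_eq_mul]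
  ring

lemma mkDerivation_rowField_minorProduct (r s : Fin 3) (τ : Equiv.Perm (Fin 5)) :
    mkDerivation K (rowField K r s) (minorProduct K τ)
      = (if r = s then C 6 else 0) * minorProduct K τ := by
  rw [mkDerivation_minorProduct (mkDerivation_rowField_genericMinor r s _ _ _)
    (mkDerivation_rowField_genericMinor r s _ _ _) (mkDerivation_rowField_genericMinor r s _ _ _)
    (mkDerivation_rowField_genericMinor r s _ _ _) (mkDerivation_rowField_genericMinor r s _ _ _)
    (mkDerivation_rowField_genericMinor r s _ _ _)]
  split_ifs
  · rw [show (6 : K) = 1 + 1 + 1 + 1 + 1 + 1 by norm_num]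
    simp only [C_add, C_1]
  · simp

/-- Scaling a column multiplies the minors which contain it, and kills the other minors. -/
lemma mkDerivation_columnField_self (τ : Equiv.Perm (Fin 5)) (m i j k : Fin 5) (hij : i ≠ j)
    (hik : i ≠ k) (hjk : j ≠ k) :
    mkDerivation K (columnField (τ m) fun r => X (r, τ m)) (genericMinor K (τ i) (τ j) (τ k))
      = C (if i = m ∨ j = m ∨ k = m then 1 else 0) * genericMinor K (τ i) (τ j) (τ k) := by
  rw [mkDerivation_genericMinor, genericMinor_eq]
  simp only [columnField, EmbeddingLike.apply_eq_iff_eq, columnDet, minorTwo]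
  by_cases hi : i = m
  · subst hi
    simp [hij.symm, hik.symm]
  · by_cases hj : j = m
    · subst hj
      simp [hi, hjk.symm]
    · by_cases hk : k = m
      · subst hk
        simp [hi, hj]
      · simp [hi, hj, hk]

lemma mkDerivation_columnField_scaling_minorProduct (τ : Equiv.Perm (Fin 5)) (m : Fin 5) :
    mkDerivation K (columnField (τ m) fun r => X (r, τ m)) (minorProduct K τ)
      = C ((![5, 4, 4, 3, 2] : Fin 5 → K) m) * minorProduct K τ := by
  rw [mkDerivation_minorProduct
    (mkDerivation_columnField_self τ m 0 1 2 (by decide) (by decide) (by decide))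
    (mkDerivation_columnField_self τ m 0 1 3 (by decide) (by decide) (by decide))
    (mkDerivation_columnField_self τ m 0 2 3 (by decide) (by decide) (by decide))
    (mkDerivation_columnField_self τ m 1 2 3 (by decide) (by decide) (by decide))
    (mkDerivation_columnField_self τ m 0 1 4 (by decide) (by decide) (by decide))
    (mkDerivation_columnField_self τ m 0 2 4 (by decide) (by decide) (by decide))]
  simp only [← C_add]
  congr 2
  fin_cases m <;> simp <;> norm_num

lemma mkDerivation_columnField_four_of_ne (τ : Equiv.Perm (Fin 5))
    (w : Fin 3 → MvPolynomial (Fin 3 × Fin 5) K) {i j k : Fin 5} (hi : i ≠ 4) (hj : j ≠ 4)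
    (hk : k ≠ 4) :
    mkDerivation K (columnField (τ 4) w) (genericMinor K (τ i) (τ j) (τ k))
      = 0 * genericMinor K (τ i) (τ j) (τ k) := by
  rw [mkDerivation_genericMinor]
  simp [columnField, columnDet, hi, hj, hk]

lemma mkDerivation_columnField_four (τ : Equiv.Perm (Fin 5))
    (w : Fin 3 → MvPolynomial (Fin 3 × Fin 5) K) {i j : Fin 5} (hi : i ≠ 4) (hj : j ≠ 4) :
    mkDerivation K (columnField (τ 4) w) (genericMinor K (τ i) (τ j) (τ 4))
      = columnDet (fun r => X (r, τ i)) (fun r => X (r, τ j)) w := by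
  rw [mkDerivation_genericMinor]
  simp [columnField, columnDet, hi, hj]

lemma mkDerivation_columnField_four_minorProduct (τ : Equiv.Perm (Fin 5))
    (w : Fin 3 → MvPolynomial (Fin 3 × Fin 5) K) {g₅ g₆ : MvPolynomial (Fin 3 × Fin 5) K}
    (h₅ : columnDet (fun r => X (r, τ 0)) (fun r => X (r, τ 1)) w
      = g₅ * genericMinor K (τ 0) (τ 1) (τ 4))
    (h₆ : columnDet (fun r => X (r, τ 0)) (fun r => X (r, τ 2)) w
      = g₆ * genericMinor K (τ 0) (τ 2) (τ 4)) :
    mkDerivation K (columnField (τ 4) w) (minorProduct K τ) = (g₅ + g₆) * minorProduct K τ := by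
  rw [mkDerivation_minorProduct
    (mkDerivation_columnField_four_of_ne τ w (by decide) (by decide) (by decide))
    (mkDerivation_columnField_four_of_ne τ w (by decide) (by decide) (by decide))
    (mkDerivation_columnField_four_of_ne τ w (by decide) (by decide) (by decide))
    (mkDerivation_columnField_four_of_ne τ w (by decide) (by decide) (by decide))
    ((mkDerivation_columnField_four τ w (by decide) (by decide)).trans h₅)
    ((mkDerivation_columnField_four τ w (by decide) (by decide)).trans h₆)]
  ring

lemma mkDerivation_logField (τ : Equiv.Perm (Fin 5)) (i : Fin 14) :
    mkDerivation K (logField K τ i) (minorProduct K τ) = logFactor K τ i * minorProduct K τ := by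
  have hE₀ : mkDerivation K (columnField (τ 4) fun r => X (r, τ 0)) (minorProduct K τ)
      = 0 * minorProduct K τ := by
    rw [mkDerivation_columnField_four_minorProduct τ _ (g₅ := 0) (g₆ := 0), add_zero]
    · simp only [columnDet]
      ring
    · simp only [columnDet]
      ring
  have hE₁ : mkDerivation K
      (columnField (τ 4) fun r => genericMinor K (τ 0) (τ 2) (τ 4) * X (r, τ 1)) (minorProduct K τ)
      = -genericMinor K (τ 0) (τ 1) (τ 2) * minorProduct K τ := by
    rw [mkDerivation_columnField_four_minorProduct τ _ (g₅ := 0)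
      (g₆ := -genericMinor K (τ 0) (τ 1) (τ 2)), zero_add]
    · simp only [columnDet]
      ring
    · rw [genericMinor_eq (τ 0) (τ 1) (τ 2)]
      simp only [columnDet, minorTwo]
      ring
  have hR := mkDerivation_rowField_minorProduct (K := K)
  have hC := mkDerivation_columnField_scaling_minorProduct (K := K) τ
  fin_cases i
  · exact hR 0 0 τ
  · exact hR 0 1 τ
  · exact hR 0 2 τ
  · exact hR 1 0 τ
  · exact hR 1 1 τ
  · exact hR 1 2 τ
  · exact hR 2 0 τ
  · exact hR 2 1 τ
  · exact hC 0
  · exact hC 1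
  · exact hC 2
  · exact hC 4
  · exact hE₀
  · exact hE₁

lemma isHomogeneous_rowField (r s : Fin 3) (t : Fin 3 × Fin 5) :
    (rowField K r s t).IsHomogeneous 1 := by
  rw [rowField]
  split_ifs
  · exact isHomogeneous_X K _
  · exact isHomogeneous_zero _ _ _

lemma isHomogeneous_columnField (j : Fin 5) {w : Fin 3 → MvPolynomial (Fin 3 × Fin 5) K} {n : ℕ}
    (hw : ∀ r, (w r).IsHomogeneous n) (t : Fin 3 × Fin 5) :
    (columnField j w t).IsHomogeneous n := by
  rw [columnField]
  split_ifs
  · exact hw _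
  · exact isHomogeneous_zero _ _ _

lemma isHomogeneous_logField (τ : Equiv.Perm (Fin 5)) (i : Fin 14) (t : Fin 3 × Fin 5) :
    (logField K τ i t).IsHomogeneous (logDegree i + 1) := by
  have hX : ∀ j r, (X (r, j) : MvPolynomial (Fin 3 × Fin 5) K).IsHomogeneous 1 :=
    fun j r => isHomogeneous_X K _
  fin_cases i
  · exact isHomogeneous_rowField 0 0 t
  · exact isHomogeneous_rowField 0 1 t
  · exact isHomogeneous_rowField 0 2 t
  · exact isHomogeneous_rowField 1 0 t
  · exact isHomogeneous_rowField 1 1 t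
  · exact isHomogeneous_rowField 1 2 t
  · exact isHomogeneous_rowField 2 0 t
  · exact isHomogeneous_rowField 2 1 t
  · exact isHomogeneous_columnField (τ 0) (hX (τ 0)) t
  · exact isHomogeneous_columnField (τ 1) (hX (τ 1)) t
  · exact isHomogeneous_columnField (τ 2) (hX (τ 2)) t
  · exact isHomogeneous_columnField (τ 4) (hX (τ 4)) t
  · exact isHomogeneous_columnField (τ 4) (hX (τ 0)) t
  · exact isHomogeneous_columnField (τ 4)
      (fun r => (isHomogeneous_genericMinor _ _ _).mul (hX (τ 1) r)) t

lemma isHomogeneous_logFactor (τ : Equiv.Perm (Fin 5)) (i : Fin 14) :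
    (logFactor K τ i).IsHomogeneous (logDegree i) := by
  fin_cases i
  all_goals first
    | exact isHomogeneous_zero _ _ _
    | exact isHomogeneous_C _ _
    | exact (isHomogeneous_genericMinor _ _ _).neg

/-- The `3 × 5` matrix with the columns `(1,0,0), (0,1,0), (0,0,1), (1,1,1), (0,1,1)` in the places
`a, b, c, d, e`. -/
def samplePoint (K : Type*) [Field K] (τ : Equiv.Perm (Fin 5)) (t : Fin 3 × Fin 5) : K :=
  (![![1, 0, 0, 1, 0], ![0, 1, 0, 1, 1], ![0, 0, 1, 1, 1]] : Fin 3 → Fin 5 → K) t.1 (τ.symm t.2)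

lemma eq_zero_of_sum_logField_samplePoint (τ : Equiv.Perm (Fin 5)) (c₀ : K) (c : Fin 14 → K)
    (h : ∀ t, c₀ * samplePoint K τ t
      + ∑ i, c i * eval (samplePoint K τ) (logField K τ i t) = 0) :
    c₀ = 0 ∧ ∀ i, c i = 0 := by
  have h' : ∀ (r : Fin 3) (j : Fin 5), c₀ * samplePoint K τ (r, τ j)
      + ∑ i, c i * eval (samplePoint K τ) (logField K τ i (r, τ j)) = 0 := fun r j => h _
  have hm : eval (samplePoint K τ) (genericMinor K (τ 0) (τ 2) (τ 4)) = -1 := by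
    simp [genericMinor_eq, minorTwo, samplePoint]
  have h00 := h' 0 0
  have h01 := h' 0 1
  have h02 := h' 0 2
  have h03 := h' 0 3
  have h04 := h' 0 4
  have h10 := h' 1 0
  have h11 := h' 1 1
  have h12 := h' 1 2
  have h13 := h' 1 3
  have h14 := h' 1 4
  have h20 := h' 2 0
  have h21 := h' 2 1
  have h22 := h' 2 2
  have h23 := h' 2 3
  have h24 := h' 2 4
  simp [Fin.sum_univ_succ, logField, rowField, columnField, hm, samplePoint]
    at h00 h01 h02 h03 h04 h10 h11 h12 h13 h14 h20 h21 h22 h23 h24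
  have k₀ : c₀ = 0 := by linear_combination h23 - h20 - h21
  have k0 : c 0 = 0 := by linear_combination h03 - k₀ - h01 - h02
  have k4 : c 4 = 0 := by linear_combination h13 - k₀ - h10 - h12
  have k8 : c 8 = 0 := by linear_combination h00 - k₀ - k0
  have k9 : c 9 = 0 := by linear_combination h11 - k₀ - k4
  have k10 : c 10 = 0 := by linear_combination h22 - k₀
  have k11 : c 11 = 0 := by linear_combination h24 - k₀ - h21
  have k12 : c 12 = 0 := by linear_combination h04 - h01 - h02
  have k13 : c 13 = 0 := by linear_combination k₀ + k4 + h12 + k11 - h14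
  refine ⟨k₀, fun i => ?_⟩
  fin_cases i
  exacts [k0, h01, h02, h10, k4, h12, h20, h21, k8, k9, k10, k11, k12, k13]

/-- The syzygies of the product of minors have a basis of thirteen linear elements and one element
of degree four. -/
lemma exists_basis_jacobianSyzygies_minorProduct [CharZero K] (τ : Equiv.Perm (Fin 5)) :
    ∃ B : Module.Basis (Fin 14) (MvPolynomial (Fin 3 × Fin 5) K)
        (jacobianSyzygies (minorProduct K τ)),
      ∀ i s, ((B i : Fin 3 × Fin 5 → MvPolynomial (Fin 3 × Fin 5) K) s).IsHomogeneous
        (logDegree i + 1) :=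
  exists_basis_jacobianSyzygies_of_logarithmic (isHomogeneous_minorProduct τ) (by norm_num)
    (squarefree_minorProduct τ) (by simp) (mkDerivation_logField τ) (isHomogeneous_logField τ)
    (isHomogeneous_logFactor τ) (by decide) (samplePoint K τ)
    (eq_zero_of_sum_logField_samplePoint τ)

end Fields

/-! ### Regularity of free hypersurfaces -/

section FreeHypersurfaces

lemma isFreeHypersurface_minorProduct {K : Type*} [Field K] [CharZero K]
    (τ : Equiv.Perm (Fin 5)) :
    HasRegularity (jacobianIdeal (minorProduct K τ)) 19 ∧
      IsFreeHypersurface (minorProduct K τ) 18 := by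
  obtain ⟨B, hB⟩ := exists_basis_jacobianSyzygies_minorProduct (K := K) τ
  have hc := linearIndependent_pderiv_of_basis B hB fun i => Nat.le_add_left 1 _
  refine ⟨?_, isHomogeneous_minorProduct τ, squarefree_minorProduct τ, hc, 14, _, B, hB⟩
  exact hasRegularity_jacobianIdeal (d := 17) (fun s => (isHomogeneous_minorProduct τ).pderiv) hc B
    hB (by norm_num) (fun i => Nat.succ_ne_zero _) 13 (by decide)

lemma jacobianIdeal_neg {σ K : Type*} [Field K] (F : MvPolynomial σ K) :
    jacobianIdeal (-F) = jacobianIdeal F := by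
  apply le_antisymm
  · rw [jacobianIdeal, Ideal.span_le]
    rintro _ ⟨s, rfl⟩
    change pderiv s (-F) ∈ jacobianIdeal F
    rw [map_neg, neg_mem_iff]
    exact Ideal.subset_span ⟨s, rfl⟩
  · rw [jacobianIdeal, Ideal.span_le]
    rintro _ ⟨s, rfl⟩
    change pderiv s F ∈ jacobianIdeal (-F)
    rw [← neg_mem_iff, ← map_neg]
    exact Ideal.subset_span ⟨s, rfl⟩

lemma jacobianSyzygies_neg {σ K : Type*} [Fintype σ] [Field K] (F : MvPolynomial σ K) :
    jacobianSyzygies (-F) = jacobianSyzygies F := by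
  ext a
  simp [mem_jacobianSyzygies]

lemma IsFreeHypersurface.neg {σ K : Type*} [Fintype σ] [Field K] {F : MvPolynomial σ K} {D : ℕ}
    (h : IsFreeHypersurface F D) : IsFreeHypersurface (-F) D := by
  obtain ⟨h1, h2, h3, h4⟩ := h
  refine ⟨h1.neg, (Associated.neg_left (Associated.refl F)).squarefree_iff.mpr h2, ?_, ?_⟩
  · rw [Fintype.linearIndependent_iff] at h3 ⊢
    intro c hc
    exact h3 c (by simpa using hc)
  · rwa [jacobianSyzygies_neg]

/-- The four products `Q_k` are the products `minorProduct` for rearrangements of the columns, up to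
sign. -/
lemma exists_midQ_eq (K : Type*) [Field K] {k : ℕ} (hk : k ∈ ({6, 7, 8, 9} : Finset ℕ)) :
    ∃ τ, midQ K k = minorProduct K τ ∨ midQ K k = -minorProduct K τ := by
  simp only [Finset.mem_insert, Finset.mem_singleton] at hk
  rcases hk with rfl | rfl | rfl | rfl
  · refine ⟨1, Or.inl ?_⟩
    simp [midQ, detMinor, minorProduct]
  · refine ⟨Equiv.swap 0 1, Or.inr ?_⟩
    have h0 : (Equiv.swap 0 1 : Equiv.Perm (Fin 5)) 0 = 1 := by decide
    have h1 : (Equiv.swap 0 1 : Equiv.Perm (Fin 5)) 1 = 0 := by decide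
    have h2 : (Equiv.swap 0 1 : Equiv.Perm (Fin 5)) 2 = 2 := by decide
    have h3 : (Equiv.swap 0 1 : Equiv.Perm (Fin 5)) 3 = 3 := by decide
    have h4 : (Equiv.swap 0 1 : Equiv.Perm (Fin 5)) 4 = 4 := by decide
    simp only [midQ, detMinor, minorProduct, h0, h1, h2, h3, h4, genericMinor_swap (1 : Fin 5) 0]
    ring
  · refine ⟨Equiv.swap 2 3, Or.inl ?_⟩
    have h0 : (Equiv.swap 2 3 : Equiv.Perm (Fin 5)) 0 = 0 := by decide
    have h1 : (Equiv.swap 2 3 : Equiv.Perm (Fin 5)) 1 = 1 := by decide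
    have h2 : (Equiv.swap 2 3 : Equiv.Perm (Fin 5)) 2 = 3 := by decide
    have h3 : (Equiv.swap 2 3 : Equiv.Perm (Fin 5)) 3 = 2 := by decide
    have h4 : (Equiv.swap 2 3 : Equiv.Perm (Fin 5)) 4 = 4 := by decide
    have e : ∀ i, genericMinor K i 3 2 = -genericMinor K i 2 3 := fun i => by
      rw [genericMinor_rotate, genericMinor_swap, ← genericMinor_rotate]
    simp only [midQ, detMinor, minorProduct, h0, h1, h2, h3, h4, e]
    ring
  · refine ⟨Equiv.swap 0 1 * Equiv.swap 2 3, Or.inr ?_⟩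
    have h0 : (Equiv.swap 0 1 * Equiv.swap 2 3 : Equiv.Perm (Fin 5)) 0 = 1 := by decide
    have h1 : (Equiv.swap 0 1 * Equiv.swap 2 3 : Equiv.Perm (Fin 5)) 1 = 0 := by decide
    have h2 : (Equiv.swap 0 1 * Equiv.swap 2 3 : Equiv.Perm (Fin 5)) 2 = 3 := by decide
    have h3 : (Equiv.swap 0 1 * Equiv.swap 2 3 : Equiv.Perm (Fin 5)) 3 = 2 := by decide
    have h4 : (Equiv.swap 0 1 * Equiv.swap 2 3 : Equiv.Perm (Fin 5)) 4 = 4 := by decide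
    have e : ∀ i, genericMinor K i 3 2 = -genericMinor K i 2 3 := fun i => by
      rw [genericMinor_rotate, genericMinor_swap, ← genericMinor_rotate]
    simp only [midQ, detMinor, minorProduct, h0, h1, h2, h3, h4, e, genericMinor_swap (1 : Fin 5) 0]
    ring

/-- In `n` variables the `n - 1` degrees are at least one and add up to `d`, so that the largest of
them is at most `d - n + 2`. -/
theorem exists_hasRegularity_le {σ K : Type*} [Fintype σ] [Field K] [CharZero K]
    {F : MvPolynomial σ K} {d : ℕ} (hF : IsFreeHypersurface F (d + 1))
    (hσ : 2 ≤ Fintype.card σ) (hd : d ≠ 0) :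
    ∃ r : ℤ, HasRegularity (jacobianIdeal F) r ∧ r ≤ 2 * d - Fintype.card σ := by
  classical
  obtain ⟨m, e, B, hB⟩ := hF.free
  have hF0 := hF.reduced.ne_zero
  have h1 := one_le_degree_of_basis_jacobianSyzygies hF.not_cone B hB
  have h2 := sum_degrees_of_basis_jacobianSyzygies hF.homogeneous (Nat.succ_ne_zero d) hF.reduced
    B hB
  have h3 := card_add_one_of_basis_jacobianSyzygies hF.homogeneous (Nat.succ_ne_zero d) hF0 B
  rw [Fintype.card_fin] at h3
  have : Nonempty (Fin m) := ⟨⟨0, by omega⟩⟩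
  obtain ⟨i₀, hi₀⟩ := Finite.exists_max e
  refine ⟨_, hasRegularity_jacobianIdeal (fun s => hF.homogeneous.pderiv) hF.not_cone B hB hd
    (fun i => by have := h1 i; omega) i₀ hi₀, ?_⟩
  have h4 : e i₀ + (m - 1) ≤ ∑ i, e i := by
    rw [← Finset.add_sum_erase _ e (Finset.mem_univ i₀)]
    have h5 := Finset.card_nsmul_le_sum (Finset.univ.erase i₀) (fun i => e i) 1 fun i _ => h1 i
    rw [Finset.card_erase_of_mem (Finset.mem_univ i₀), Finset.card_univ, Fintype.card_fin,
      smul_eq_mul, mul_one] at h5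
    omega
  omega

end FreeHypersurfaces
end

theorem corollary1p7 {K : Type*} [Field K] [CharZero K] :
    (∀ k ∈ ({6, 7, 8, 9} : Finset ℕ),
      HasRegularity (jacobianIdeal (midQ K k)) 19 ∧ IsFreeHypersurface (midQ K k) 18) ∧
    (∀ F : MvPolynomial (Fin 3 × Fin 5) K, IsFreeHypersurface F 18 →
      ∃ r : ℤ, HasRegularity (jacobianIdeal F) r ∧ r ≤ 19) := by
  refine ⟨fun k hk => ?_, fun F hF => ?_⟩
  · obtain ⟨τ, h | h⟩ := exists_midQ_eq K hk
    · rw [h]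
      exact isFreeHypersurface_minorProduct τ
    · obtain ⟨h1, h2⟩ := isFreeHypersurface_minorProduct (K := K) τ
      rw [h, jacobianIdeal_neg]
      exact ⟨h1, h2.neg⟩
  · obtain ⟨r, hr, hle⟩ := exists_hasRegularity_le (d := 17) hF (by simp) (by norm_num)
    exact ⟨r, hr, by simpa using hle⟩
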